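/- Let $R:(0,\infty)\to[0,\infty)$ be Borel measurable and locally integrable on $(0,\infty)$. **Standing assumption.** $\pi$ is a probability measure on $(0,\infty)$, absolutely continuous with respect to Lebesgue measure, whose distribution function $F$ is a stationary solution of the growth–fragmentation equation: for all $t,x\ge 0$, $$F(x)=F(e^{-t}x)+\int_0^t (e^{s-t}x)^2\left[\int_{e^{s-t}x}^\infty \frac{R(z)}{z}\,dF(z)\right]ds .$$ **Operator.** For $f\in C_c^1(0,\infty)$ and $x>0$ set $$\mathscr L f(x)=xf'(x)+xR(x)\left[\int_0^x\frac{2u}{x^2}f(u)\,du-f(x)\right].$$ **Cell process.** Let $U_1,U_2,\dots$ be i.i.d. uniform on $(0,1)$ and, for $z>0$ and $t\ge 0$, let $S_z(t)=\exp\bigl(-\int_z^{ze^t}R(u)\,du\bigr)$, with generalized inverse $S_z^{-1}(u)=\inf\{t\ge0: S_z(t)\le u\}$ ($\inf\emptyset=\infty$). For $x>0$ set $\tau_0=0$, $J_k=\sqrt{U_{2k}}$, $Y_k=xe^{\tau_k}\prod_{j=1}^kJ_j$ (so $Y_0=x$), and $\tau_{k}=\tau_{k-1}+S_{Y_{k-1}}^{-1}(U_{2k-1})$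 for $k\ge1$, with $\tau_k=\infty$ if $\tau_{k-1}=\infty$. The cell process started at $x$ is $X^x_t=xe^t\prod_{j=1}^kJ_j$ if $\tau_k\le t<\tau_{k+1}$ for some $k\ge 0$, and $X^x_t=0$ if $t\ge\lim_k\tau_k$; moreover $X^0_t=0$ for all $t$. Let $P_tf(x)=\mathbb E[f(X^x_t)]$ be its transition semigroup on $[0,\infty)$, and for a probability measure $\mu$ let $\mu P_t$ be the measure $A\mapsto\int \mathbb P(X^x_t\in A)\,\mu(dx)$. **Proposition.** Let $(\mu_t)_{t\ge0}$ be a family of Borel probability measures, absolutely continuous with respect to $\pi$, such that $t\mapsto\mu_t$ is Borel measurable and $$\sup_{t\ge0}\left\|\frac{d\mu_t}{d\pi}\right\|_{L^\infty(\pi)}<\infty .$$ Suppose that for all $f\in C_c^1(0,\infty)$ and all $t\ge0$, $$\int f\,d\mu_t-\int f\,d\mu_0=\int_0^t\left(\int \mathscr L f\,d\mu_s\right)ds .$$ Then $\mu_t=\mu_0P_t$ for all $t\ge0$. -/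

import Mathlib

open MeasureTheory ProbabilityTheory Set Filter
open scoped NNReal ENNReal

/-!
The state space `[0, ∞)` is regarded as a subset of `ℝ`: measures on `(0, ∞)` or `[0, ∞)` are
measures on `ℝ` that give no mass to the rest of the line. A non-negative function `R` on
`(0, ∞)` is a map `R : ℝ → ℝ≥0`; its values on `(-∞, 0]` play no role.
-/

namespace CellProcess

/-! ### The growth-fragmentation equation and its stationary solutions -/

/-- `ν = (ν_t)_{t ≥ 0}` is a tight, Borel measurable family of probability measures on `(0, ∞)`,
absolutely continuous with respect to Lebesgue measure, whose distribution functions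
`F_t(x) = ν_t([0, x])` solve
`F_t(x) = F_0(e^{-t} x) + ∫_0^t (e^{s-t} x)^2 ∫_{e^{s-t} x}^∞ R(z) / z dF_s(z) ds`
for all `t, x ≥ 0`. -/
structure IsGrowthFragmentationSolution (R : ℝ → ℝ≥0) (ν : ℝ≥0 → Measure ℝ) : Prop where
  measurable : Measurable ν
  isProbabilityMeasure : ∀ t, IsProbabilityMeasure (ν t)
  nonpos_eq_zero : ∀ t, ν t (Iic 0) = 0
  absolutelyContinuous : ∀ t, ν t ≪ volume
  tight : IsTightMeasureSet (range ν)
  equation : ∀ (t : ℝ≥0) (x : ℝ), 0 ≤ x →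
    ν t (Iic x) = ν 0 (Iic (Real.exp (-t) * x)) +
      ∫⁻ s in Icc (0 : ℝ) t, ENNReal.ofReal ((Real.exp (s - t) * x) ^ 2) *
        ∫⁻ z in Ioi (Real.exp (s - t) * x), (R z : ℝ≥0∞) / ENNReal.ofReal z ∂(ν s.toNNReal)

/-- `π` is a stationary solution: the constant family `ν_t = π` solves the
growth-fragmentation equation. -/
def IsStationary (R : ℝ → ℝ≥0) (π : Measure ℝ) : Prop :=
  IsGrowthFragmentationSolution R (fun _ => π)

/-! ### The operator -/

/-- `f ∈ C_c¹(0, ∞)`, extended by zero to `ℝ`. -/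
structure IsTestFunction (f : ℝ → ℝ) : Prop where
  contDiff : ContDiff ℝ 1 f
  hasCompactSupport : HasCompactSupport f
  tsupport_subset : tsupport f ⊆ Ioi 0

/-- `𝓛 f(x) = x f'(x) + x R(x) [∫_0^x (2u / x²) f(u) du - f(x)]`. -/
noncomputable def generator (R : ℝ → ℝ≥0) (f : ℝ → ℝ) (x : ℝ) : ℝ :=
  x * deriv f x + x * R x * ((∫ u in (0 : ℝ)..x, 2 * u / x ^ 2 * f u) - f x)

/-! ### The cell process -/

/-- The survivor function `S_z(t) = exp(-∫_z^{z e^t} R(u) du)`, for `z > 0`. -/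
noncomputable def survivor (R : ℝ → ℝ≥0) (z : ℝ) (t : ℝ≥0) : ℝ≥0∞ :=
  EReal.exp (-((∫⁻ u in Ioc z (z * Real.exp t), (R u : ℝ≥0∞) : ℝ≥0∞) : EReal))

/-- The generalized inverse `S_z⁻¹(u) = inf {t ≥ 0 : S_z(t) ≤ u}`, with `inf ∅ = ∞`. -/
noncomputable def waitingTime (R : ℝ → ℝ≥0) (z u : ℝ) : ℝ≥0∞ :=
  ⨅ (t : ℝ≥0) (_ : survivor R z t ≤ ENNReal.ofReal u), (t : ℝ≥0∞)

/-- The uniform distribution on `(0, 1)`. -/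
noncomputable def uniform : Measure ℝ := volume.restrict (Ioo 0 1)

instance : IsProbabilityMeasure uniform :=
  ⟨by simp [uniform]⟩

/-- The law of an i.i.d. sequence of uniform random variables on `(0, 1)`. In
`ω = (ω 0, ω 1, ...)` the entry `ω (2k)` decides the time of the `(k+1)`-st jump and
`ω (2k + 1)` its size. -/
noncomputable def noise : Measure (ℕ → ℝ) := Measure.infinitePi fun _ => uniform

instance : IsProbabilityMeasure noise := by
  unfold noise; infer_instance

/-- The product `J_1 ⋯ J_k` of the first `k` jump factors, where `J_{j+1} = √(ω (2j + 1))`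
has density `2u` on `(0, 1)`. -/
noncomputable def jumpProd (ω : ℕ → ℝ) (k : ℕ) : ℝ :=
  ∏ j ∈ Finset.range k, √(ω (2 * j + 1))

/-- The jump times of the process started at `x`: `τ_0 = 0` and
`τ_{k+1} = τ_k + S_{Y_k}⁻¹(ω (2k))`, with `Y_k = x e^{τ_k} J_1 ⋯ J_k` (so `Y_0 = x`);
if `τ_k = ∞` then also `τ_{k+1} = ∞`. -/
noncomputable def jumpTime (R : ℝ → ℝ≥0) (x : ℝ) (ω : ℕ → ℝ) : ℕ → ℝ≥0∞
  | 0 => 0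
  | k + 1 => jumpTime R x ω k +
      waitingTime R (x * Real.exp (jumpTime R x ω k).toReal * jumpProd ω k) (ω (2 * k))

open Classical in
/-- The cell process started at `x ≥ 0`: `X_t = x e^t J_1 ⋯ J_k` if `τ_k ≤ t < τ_{k+1}`
(at most one `k` has this property), and `X_t = 0` if `t ≥ lim τ_k`. -/
noncomputable def path (R : ℝ → ℝ≥0) (x : ℝ) (ω : ℕ → ℝ) (t : ℝ≥0) : ℝ :=
  if h : ∃ k, jumpTime R x ω k ≤ t ∧ (t : ℝ≥0∞) < jumpTime R x ω (k + 1) then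
    x * Real.exp t * jumpProd ω (Nat.find h)
  else 0

/-! ### Measurability, and the transition kernels -/

theorem survivor_antitone {R : ℝ → ℝ≥0} {z : ℝ} {s t : ℝ≥0} (h : s ≤ t) :
    survivor R z t ≤ survivor R z s := by
  refine EReal.exp_monotone (EReal.neg_le_neg_iff.2 (EReal.coe_ennreal_le_coe_ennreal_iff.2 ?_))
  rcases le_total 0 z with hz | hz
  · refine lintegral_mono_set (Ioc_subset_Ioc_right ?_)
    gcongr
  · have : z * Real.exp s ≤ z := by
      nlinarith [Real.add_one_le_exp (s : ℝ), s.coe_nonneg]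
    simp [Ioc_eq_empty (not_lt.2 this)]

theorem measurable_survivor {R : ℝ → ℝ≥0} (hR : Measurable R) (t : ℝ≥0) :
    Measurable fun z => survivor R z t := by
  have h : Measurable fun z : ℝ => ∫⁻ u in Ioc z (z * Real.exp t), (R u : ℝ≥0∞) := by
    have h1 : (fun z : ℝ => ∫⁻ u in Ioc z (z * Real.exp t), (R u : ℝ≥0∞)) = fun z : ℝ =>
        ∫⁻ u, ({p : ℝ × ℝ | p.1 < p.2 ∧ p.2 ≤ p.1 * Real.exp t}).indicator
          (fun p => (R p.2 : ℝ≥0∞)) (z, u) := by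
      funext z
      rw [← lintegral_indicator measurableSet_Ioc]
      rfl
    rw [h1]
    refine Measurable.lintegral_prod_right' (Measurable.indicator (by fun_prop) ?_)
    exact (measurableSet_lt measurable_fst measurable_snd).inter
      (measurableSet_le measurable_snd (by fun_prop))
  exact EReal.exp_monotone.measurable.comp h.coe_ereal_ennreal.neg

theorem measurable_waitingTime {R : ℝ → ℝ≥0} (hR : Measurable R) :
    Measurable fun p : ℝ × ℝ => waitingTime R p.1 p.2 := by
  refine measurable_of_Iio fun a => ?_
  have h : (fun p : ℝ × ℝ => waitingTime R p.1 p.2) ⁻¹' Iio a =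
      ⋃ q : {q : ℚ // ((Real.toNNReal q : ℝ≥0) : ℝ≥0∞) < a},
        {p : ℝ × ℝ | survivor R p.1 (Real.toNNReal q.1) ≤ ENNReal.ofReal p.2} := by
    ext p
    simp only [waitingTime, mem_preimage, mem_Iio, iInf_lt_iff, mem_iUnion, mem_ofPred_eq]
    constructor
    · rintro ⟨t, ht, hta⟩
      obtain ⟨q, -, h1, h2⟩ := ENNReal.lt_iff_exists_rat_btwn.1 hta
      exact ⟨⟨q, h2⟩, (survivor_antitone (ENNReal.coe_lt_coe.1 h1).le).trans ht⟩
    · rintro ⟨⟨q, hq⟩, h1⟩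
      exact ⟨_, h1, hq⟩
  rw [h]
  refine MeasurableSet.iUnion fun q => measurableSet_le ?_ (by fun_prop)
  exact (measurable_survivor hR _).comp measurable_fst

theorem measurable_jumpProd (k : ℕ) : Measurable fun ω : ℕ → ℝ => jumpProd ω k := by
  unfold jumpProd
  fun_prop

theorem measurable_jumpTime {R : ℝ → ℝ≥0} (hR : Measurable R) (k : ℕ) :
    Measurable fun p : ℝ × (ℕ → ℝ) => jumpTime R p.1 p.2 k := by
  induction k with
  | zero => exact measurable_const
  | succ k ih =>
    have key (T : ℝ × (ℕ → ℝ) → ℝ≥0∞) (hT : Measurable T) : Measurable fun p : ℝ × (ℕ → ℝ) =>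
        T p + waitingTime R (p.1 * Real.exp (T p).toReal * jumpProd p.2 k) (p.2 (2 * k)) := by
      have h1 : Measurable fun p : ℝ × (ℕ → ℝ) => jumpProd p.2 k :=
        (measurable_jumpProd k).comp measurable_snd
      have h2 : Measurable fun p : ℝ × (ℕ → ℝ) => p.2 (2 * k) :=
        (measurable_pi_apply (2 * k)).comp measurable_snd
      have h3 : Measurable fun p : ℝ × (ℕ → ℝ) => p.1 * Real.exp (T p).toReal * jumpProd p.2 k :=
        (measurable_fst.mul (Real.measurable_exp.comp hT.ennreal_toReal)).mul h1
      have h4 := Measurable.comp (measurable_waitingTime hR) (h3.prodMk h2)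
      simp only [Function.comp_def] at h4
      exact Measurable.add hT h4
    exact key _ ih

theorem measurable_path {R : ℝ → ℝ≥0} (hR : Measurable R) (t : ℝ≥0) :
    Measurable fun p : ℝ × (ℕ → ℝ) => path R p.1 p.2 t := by
  classical
  have hE (k : ℕ) : MeasurableSet {p : ℝ × (ℕ → ℝ) |
      jumpTime R p.1 p.2 k ≤ t ∧ (t : ℝ≥0∞) < jumpTime R p.1 p.2 (k + 1)} :=
    (measurableSet_le (measurable_jumpTime hR k) measurable_const).inter
      (measurableSet_lt measurable_const (measurable_jumpTime hR (k + 1)))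
  have hlim (N : ℕ) : Measurable fun p : ℝ × (ℕ → ℝ) =>
      ∑ k ∈ Finset.range N, if (jumpTime R p.1 p.2 k ≤ t ∧
          (t : ℝ≥0∞) < jumpTime R p.1 p.2 (k + 1)) ∧
          ∀ j < k, ¬ (jumpTime R p.1 p.2 j ≤ t ∧ (t : ℝ≥0∞) < jumpTime R p.1 p.2 (j + 1))
        then p.1 * Real.exp t * jumpProd p.2 k else 0 := by
    refine Finset.measurable_fun_sum _ fun k _ => Measurable.ite ?_ ?_ measurable_const
    · refine (hE k).inter ?_
      have h : {p : ℝ × (ℕ → ℝ) | ∀ j < k, ¬ (jumpTime R p.1 p.2 j ≤ t ∧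
          (t : ℝ≥0∞) < jumpTime R p.1 p.2 (j + 1))} = ⋂ j, ⋂ (_ : j < k),
          {p : ℝ × (ℕ → ℝ) | jumpTime R p.1 p.2 j ≤ t ∧
            (t : ℝ≥0∞) < jumpTime R p.1 p.2 (j + 1)}ᶜ := by
        ext p
        simp only [mem_iInter]
        rfl
      have h' : MeasurableSet {p : ℝ × (ℕ → ℝ) | ∀ j < k, ¬ (jumpTime R p.1 p.2 j ≤ t ∧
          (t : ℝ≥0∞) < jumpTime R p.1 p.2 (j + 1))} := by
        rw [h]
        exact MeasurableSet.iInter fun j => MeasurableSet.iInter fun _ => (hE j).compl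
      exact h'
    · exact (measurable_fst.mul_const _).mul ((measurable_jumpProd k).comp measurable_snd)
  refine measurable_of_tendsto_metrizable hlim (tendsto_pi_nhds.2 fun p => ?_)
  by_cases h : ∃ k, jumpTime R p.1 p.2 k ≤ t ∧ (t : ℝ≥0∞) < jumpTime R p.1 p.2 (k + 1)
  · refine tendsto_atTop_of_eventually_const (i₀ := Nat.find h + 1) fun N hN => ?_
    rw [path, dif_pos h, Finset.sum_eq_single (Nat.find h)]
    · rw [if_pos ⟨Nat.find_spec h, fun j hj => Nat.find_min h hj⟩]
    · intro k _ hk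
      refine if_neg fun hh => hk ((Nat.find_eq_iff h).2 hh).symm
    · intro hh
      exact absurd (Finset.mem_range.2 (by omega)) hh
  · have h0 : path R p.1 p.2 t = 0 := dif_neg h
    rw [h0]
    refine tendsto_const_nhds.congr fun N => (Finset.sum_eq_zero fun k _ => ?_).symm
    exact if_neg fun hh => h ⟨k, hh.1⟩

/-- The transition semigroup of the cell process: `transition hR t x` is the law of `X_t` under
`ℙ_x`, so that `P_t f(x) = 𝔼_x[f(X_t)] = ∫ y, f y ∂(transition hR t x)`. The measure `μ P_t` is
`μ.bind (transition hR t)`, the law of `X_t` if `X_0` has law `μ`. -/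
noncomputable def transition {R : ℝ → ℝ≥0} (hR : Measurable R) (t : ℝ≥0) : Kernel ℝ ℝ where
  toFun x := noise.map fun ω => path R x ω t
  measurable' := by
    refine Measure.measurable_of_measurable_coe _ fun s hs => ?_
    have h (x : ℝ) : (noise.map fun ω => path R x ω t) s =
        noise (Prod.mk x ⁻¹' ((fun p : ℝ × (ℕ → ℝ) => path R p.1 p.2 t) ⁻¹' s)) :=
      Measure.map_apply ((measurable_path hR t).comp measurable_prodMk_left) hs
    simp only [h]
    exact measurable_measure_prodMk_left (measurable_path hR t hs)

end CellProcess

namespace CellProcess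

/-! ### The density of a stationary solution -/

/-- `G(y) = ∫_y^∞ R(z) / z dπ(z)`. -/
noncomputable def tailRate (R : ℝ → ℝ≥0) (π : Measure ℝ) (y : ℝ) : ℝ≥0∞ :=
  ∫⁻ z in Ioi y, (R z : ℝ≥0∞) / ENNReal.ofReal z ∂π

theorem tailRate_antitone (R : ℝ → ℝ≥0) (π : Measure ℝ) : Antitone (tailRate R π) :=
  fun _ _ h => lintegral_mono_set (Ioi_subset_Ioi h)

theorem lintegral_Icc_exp_comp (g : ℝ → ℝ≥0∞) {x : ℝ} (hx : 0 < x) {t : ℝ} (ht : 0 ≤ t) :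
    ∫⁻ s in Icc (0 : ℝ) t, ENNReal.ofReal (Real.exp (s - t) * x) * g (Real.exp (s - t) * x) =
      ∫⁻ y in Icc (Real.exp (-t) * x) x, g y := by
  have hmono : StrictMono fun s : ℝ => Real.exp (s - t) * x := fun a b h => by
    have : Real.exp (a - t) < Real.exp (b - t) := Real.exp_lt_exp.2 (by linarith)
    exact mul_lt_mul_of_pos_right this hx
  have him : (fun s : ℝ => Real.exp (s - t) * x) '' Icc 0 t = Icc (Real.exp (-t) * x) x := by
    have hc : ContinuousOn (fun s : ℝ => Real.exp (s - t) * x) (Icc 0 t) := by fun_prop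
    have := hc.image_Icc_of_monotoneOn ht (hmono.monotone.monotoneOn _)
    simpa using this
  rw [← him, lintegral_image_eq_lintegral_abs_deriv_mul measurableSet_Icc
    (f' := fun s => Real.exp (s - t) * x) ?_ hmono.injective.injOn]
  · refine lintegral_congr fun s => ?_
    rw [abs_of_pos (by positivity)]
  · intro s _
    have h : HasDerivAt (fun s : ℝ => Real.exp (s - t) * x) (Real.exp (s - t) * 1 * x) s :=
      (((hasDerivAt_id s).sub_const t).exp).mul_const x
    simpa using h.hasDerivWithinAt

namespace IsStationary

variable {R : ℝ → ℝ≥0} {π : Measure ℝ}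

theorem isProbabilityMeasure (h : IsStationary R π) : IsProbabilityMeasure π :=
  IsGrowthFragmentationSolution.isProbabilityMeasure h 0

theorem measure_Iic_zero (h : IsStationary R π) : π (Iic 0) = 0 :=
  IsGrowthFragmentationSolution.nonpos_eq_zero h 0

theorem measure_Ioc (h : IsStationary R π) {a x : ℝ} (ha : 0 < a) (hax : a ≤ x) :
    π (Ioc a x) = ∫⁻ y in Ioc a x, ENNReal.ofReal y * tailRate R π y := by
  have := h.isProbabilityMeasure
  have hx : 0 < x := ha.trans_le hax
  have ht : 0 ≤ Real.log (x / a) := Real.log_nonneg ((one_le_div ha).2 hax)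
  have heq := IsGrowthFragmentationSolution.equation h (Real.log (x / a)).toNNReal x hx.le
  have he : Real.exp (-(Real.log (x / a))) * x = a := by
    rw [Real.exp_neg, Real.exp_log (by positivity)]
    field_simp
  rw [Real.coe_toNNReal _ ht, he] at heq
  have hint : ∫⁻ s in Icc (0 : ℝ) (Real.log (x / a)),
      ENNReal.ofReal ((Real.exp (s - Real.log (x / a)) * x) ^ 2) *
        ∫⁻ z in Ioi (Real.exp (s - Real.log (x / a)) * x), (R z : ℝ≥0∞) / ENNReal.ofReal z ∂π =
      ∫⁻ y in Ioc a x, ENNReal.ofReal y * tailRate R π y := by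
    have := lintegral_Icc_exp_comp (fun y => ENNReal.ofReal y * tailRate R π y) hx ht
    rw [he] at this
    rw [restrict_Ioc_eq_restrict_Icc, ← this]
    refine lintegral_congr fun s => ?_
    rw [sq, ENNReal.ofReal_mul (by positivity), mul_assoc]
    rfl
  rw [hint] at heq
  rw [show π (Ioc a x) = π (Iic x \ Iic a) by rw [Iic_sdiff_Iic], measure_sdiff (Iic_subset_Iic.2 hax) measurableSet_Iic.nullMeasurableSet
    (measure_ne_top _ _), heq, ENNReal.add_sub_cancel_left (measure_ne_top _ _)]

theorem tailRate_lt_top (h : IsStationary R π) {y : ℝ} (hy : 0 < y) : tailRate R π y < ∞ := by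
  have := h.isProbabilityMeasure
  have h1 := h.measure_Ioc (half_pos hy) (half_le_self hy.le)
  have h2 : ENNReal.ofReal (y / 2) * tailRate R π y * ENNReal.ofReal (y / 2) ≤ 1 := by
    calc _ = ∫⁻ _ in Ioc (y / 2) y, ENNReal.ofReal (y / 2) * tailRate R π y := by
            rw [lintegral_const, Measure.restrict_apply_univ, Real.volume_Ioc, sub_half]
      _ ≤ ∫⁻ z in Ioc (y / 2) y, ENNReal.ofReal z * tailRate R π z := by
            refine setLIntegral_mono' measurableSet_Ioc fun z hz => ?_
            exact mul_le_mul' (ENNReal.ofReal_le_ofReal hz.1.le) (tailRate_antitone R π hz.2)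
      _ = π (Ioc (y / 2) y) := h1.symm
      _ ≤ 1 := prob_le_one
  by_contra hcon
  have h3 : ENNReal.ofReal (y / 2) ≠ 0 := by simpa using hy
  rw [not_lt_top_iff.1 hcon, ENNReal.mul_top h3, ENNReal.top_mul h3] at h2
  exact absurd h2 (by simp)

theorem eq_withDensity (h : IsStationary R π) :
    π = (volume.restrict (Ioi 0)).withDensity fun y => ENNReal.ofReal y * tailRate R π y := by
  have := h.isProbabilityMeasure
  refine Measure.ext_of_Iic _ _ fun x => ?_
  rw [withDensity_apply _ measurableSet_Iic, Measure.restrict_restrict measurableSet_Iic]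
  have hU : Iic x ∩ Ioi 0 = ⋃ n : ℕ, Ioc (1 / ((n : ℝ) + 1)) x := by
    ext y
    simp only [mem_inter_iff, mem_Iic, mem_Ioi, mem_iUnion, mem_Ioc]
    constructor
    · rintro ⟨h1, h2⟩
      obtain ⟨n, hn⟩ := exists_nat_one_div_lt h2
      exact ⟨n, hn, h1⟩
    · rintro ⟨n, h1, h2⟩
      exact ⟨h2, lt_trans (by positivity) h1⟩
  have hmono : Monotone fun n : ℕ => Ioc (1 / ((n : ℝ) + 1)) x := fun m n hmn =>
    Ioc_subset_Ioc_left (one_div_le_one_div_of_le (by positivity) (by gcongr))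
  have hπ : π (Iic x) = π (Iic x ∩ Ioi 0) := by
    refine le_antisymm ?_ (measure_mono inter_subset_left)
    calc π (Iic x) ≤ π ((Iic x ∩ Ioi 0) ∪ Iic 0) := measure_mono fun y hy => by
            rcases le_or_gt y 0 with h0 | h0
            · exact Or.inr h0
            · exact Or.inl ⟨hy, h0⟩
      _ ≤ π (Iic x ∩ Ioi 0) + π (Iic 0) := measure_union_le _ _
      _ = _ := by rw [h.measure_Iic_zero, add_zero]
  rw [hπ, hU, hmono.measure_iUnion, setLIntegral_iUnion_of_directed _ hmono.directed_le]
  congr 1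
  funext n
  rcases le_total (1 / ((n : ℝ) + 1)) x with hle | hle
  · exact h.measure_Ioc (by positivity) hle
  · rw [Ioc_eq_empty (not_lt.2 hle)]
    simp

/-- A stationary solution has a bounded density on every interval `(a, b]` with `0 < a`. -/
theorem restrict_Ioc_le (h : IsStationary R π) {a b : ℝ} (ha : 0 < a) :
    π.restrict (Ioc a b) ≤
      (ENNReal.ofReal b * tailRate R π a) • volume.restrict (Ioc a b) := by
  conv_lhs => rw [h.eq_withDensity]
  rw [restrict_withDensity measurableSet_Ioc, Measure.restrict_restrict measurableSet_Ioc,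
    inter_eq_left.2 (show Ioc a b ⊆ Ioi 0 from fun y hy => ha.trans hy.1), ← withDensity_const]
  refine withDensity_mono ?_
  filter_upwards [ae_restrict_mem measurableSet_Ioc] with y hy
  exact mul_le_mul' (ENNReal.ofReal_le_ofReal hy.2) (tailRate_antitone R π hy.1.le)

theorem lintegral_rate (h : IsStationary R π) (hR : Measurable R) :
    ∫⁻ z, ENNReal.ofReal z * R z ∂π = 2 := by
  have := h.isProbabilityMeasure
  have hpos : ∀ᵐ z ∂π, 0 < z := by
    rw [ae_iff]
    simpa [not_lt, Iic_def] using h.measure_Iic_zero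
  have hsq (z : ℝ) (hz : 0 < z) : ∫⁻ y in Ioc 0 z, ENNReal.ofReal (2 * y) =
      ENNReal.ofReal z * ENNReal.ofReal z := by
    rw [← ofReal_integral_eq_lintegral_ofReal]
    · rw [← intervalIntegral.integral_of_le hz.le, intervalIntegral.integral_const_mul,
        integral_id, ← ENNReal.ofReal_mul hz.le]
      congr 1
      ring
    · exact (Continuous.integrableOn_Icc (by fun_prop)).mono_set Ioc_subset_Icc_self
    · filter_upwards [ae_restrict_mem measurableSet_Ioc] with y hy
      have := hy.1
      positivity
  have h1 : ∀ᵐ z ∂π, ENNReal.ofReal z * R z = ∫⁻ y in Ioi (0 : ℝ),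
      (Iio z).indicator (fun y => ENNReal.ofReal (2 * y)) y *
        ((R z : ℝ≥0∞) / ENNReal.ofReal z) := by
    filter_upwards [hpos] with z hz
    have h0 : ENNReal.ofReal z ≠ 0 := by simpa using hz
    rw [lintegral_mul_const _ ((by fun_prop : Measurable fun y : ℝ =>
        ENNReal.ofReal (2 * y)).indicator measurableSet_Iio),
      lintegral_indicator measurableSet_Iio, Measure.restrict_restrict measurableSet_Iio,
      inter_comm, Ioi_inter_Iio, restrict_Ioo_eq_restrict_Ioc, hsq z hz, mul_assoc,
      ENNReal.mul_div_cancel h0 ENNReal.ofReal_ne_top]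
  have hm : Measurable fun p : ℝ × ℝ =>
      (Iio p.1).indicator (fun y => ENNReal.ofReal (2 * y)) p.2 *
        ((R p.1 : ℝ≥0∞) / ENNReal.ofReal p.1) := by
    have : Measurable ({p : ℝ × ℝ | p.2 < p.1}.indicator fun p => ENNReal.ofReal (2 * p.2)) :=
      Measurable.indicator (by fun_prop) (measurableSet_lt measurable_snd measurable_fst)
    exact this.mul (by fun_prop)
  rw [lintegral_congr_ae h1, lintegral_lintegral_swap hm.aemeasurable]
  have h2 (y : ℝ) (hy : 0 < y) : ∫⁻ z, (Iio z).indicator (fun y => ENNReal.ofReal (2 * y)) y *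
        ((R z : ℝ≥0∞) / ENNReal.ofReal z) ∂π =
      2 * (ENNReal.ofReal y * tailRate R π y) := by
    rw [tailRate, ← lintegral_indicator measurableSet_Ioi, ← mul_assoc,
      ← lintegral_const_mul _ (Measurable.indicator (by fun_prop) measurableSet_Ioi)]
    refine lintegral_congr fun z => ?_
    by_cases hz : y < z
    · rw [indicator_of_mem (show y ∈ Iio z from hz), indicator_of_mem (show z ∈ Ioi y from hz),
        ENNReal.ofReal_mul zero_le_two]
      simp
    · rw [indicator_of_notMem (show y ∉ Iio z from hz),
        indicator_of_notMem (show z ∉ Ioi y from hz)]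
      simp
  rw [setLIntegral_congr_fun measurableSet_Ioi h2, lintegral_const_mul']
  · have h3 : ∫⁻ y in Ioi (0 : ℝ), ENNReal.ofReal y * tailRate R π y = π univ := by
      conv_rhs => rw [h.eq_withDensity]
      rw [withDensity_apply _ MeasurableSet.univ, Measure.restrict_univ]
    rw [h3, measure_univ, mul_one]
  · simp

end IsStationary

/-! ### The integrating factor -/

/-- `∫_1^x R(u) du`, for `x > 0`. -/
noncomputable def ratePrimitive (R : ℝ → ℝ≥0) (x : ℝ) : ℝ := ∫ u in (1 : ℝ)..x, (R u : ℝ)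

/-- `exp (∫_1^x R(u) du)` on `(0, ∞)`, extended by zero. -/
noncomputable def weight (R : ℝ → ℝ≥0) : ℝ → ℝ :=
  (Ioi 0).indicator fun x => Real.exp (ratePrimitive R x)

section Weight

variable {R : ℝ → ℝ≥0}

theorem intervalIntegrable_rate (hRloc : LocallyIntegrableOn (fun x => (R x : ℝ)) (Ioi 0))
    {a b : ℝ} (ha : 0 < a) (hb : 0 < b) :
    IntervalIntegrable (fun x => (R x : ℝ)) volume a b :=
  (hRloc.integrableOn_compact_subset (fun _ hx => lt_of_lt_of_le (lt_min ha hb) hx.1)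
    isCompact_uIcc).intervalIntegrable

theorem ratePrimitive_sub (hRloc : LocallyIntegrableOn (fun x => (R x : ℝ)) (Ioi 0))
    {a b : ℝ} (ha : 0 < a) (hb : 0 < b) :
    ratePrimitive R b - ratePrimitive R a = ∫ u in a..b, (R u : ℝ) :=
  intervalIntegral.integral_interval_sub_left (intervalIntegrable_rate hRloc one_pos hb)
    (intervalIntegrable_rate hRloc one_pos ha)

theorem ratePrimitive_mono (hRloc : LocallyIntegrableOn (fun x => (R x : ℝ)) (Ioi 0))
    {a b : ℝ} (ha : 0 < a) (hab : a ≤ b) : ratePrimitive R a ≤ ratePrimitive R b := by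
  rw [← sub_nonneg, ratePrimitive_sub hRloc ha (ha.trans_le hab)]
  exact intervalIntegral.integral_nonneg hab fun u _ => (R u).coe_nonneg

theorem continuousOn_ratePrimitive
    (hRloc : LocallyIntegrableOn (fun x => (R x : ℝ)) (Ioi 0)) :
    ContinuousOn (ratePrimitive R) (Ioi 0) := by
  intro x hx
  have hx : 0 < x := hx
  have h1 : ContinuousOn (fun y => ∫ u in x / 2..y, (R u : ℝ)) (uIcc (x / 2) (2 * x)) :=
    intervalIntegral.continuousOn_primitive_interval
      (hRloc.integrableOn_compact_subset
        (fun y hy => lt_of_lt_of_le (lt_min (by positivity) (by positivity)) hy.1)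
        isCompact_uIcc)
  rw [uIcc_of_le (by linarith)] at h1
  have hmem : Icc (x / 2) (2 * x) ∈ nhds x := Icc_mem_nhds (by linarith) (by linarith)
  have h2 : ContinuousAt (fun y => ratePrimitive R (x / 2) + ∫ u in x / 2..y, (R u : ℝ)) x :=
    (h1.continuousAt hmem).const_add _
  refine (h2.congr ?_).continuousWithinAt
  filter_upwards [hmem] with y hy
  rw [← ratePrimitive_sub hRloc (by linarith) (lt_of_lt_of_le (by linarith) hy.1)]
  ring

theorem weight_of_pos {x : ℝ} (hx : 0 < x) : weight R x = Real.exp (ratePrimitive R x) :=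
  indicator_of_mem (show x ∈ Ioi 0 from hx) _

theorem weight_of_nonpos {x : ℝ} (hx : x ≤ 0) : weight R x = 0 :=
  indicator_of_notMem (by simpa using hx) _

theorem weight_nonneg (x : ℝ) : 0 ≤ weight R x :=
  indicator_nonneg (fun _ _ => (Real.exp_pos _).le) x

theorem measurable_weight (hRloc : LocallyIntegrableOn (fun x => (R x : ℝ)) (Ioi 0)) :
    Measurable (weight R) := by
  classical
  rw [weight, ← piecewise_eq_indicator]
  exact (Real.continuous_exp.comp_continuousOn (continuousOn_ratePrimitive hRloc)).measurable_piecewise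
    continuousOn_const measurableSet_Ioi

theorem weight_mono (hRloc : LocallyIntegrableOn (fun x => (R x : ℝ)) (Ioi 0)) :
    Monotone (weight R) := by
  intro a b hab
  rcases le_or_gt a 0 with ha | ha
  · rw [weight_of_nonpos ha]
    exact weight_nonneg b
  · rw [weight_of_pos ha, weight_of_pos (ha.trans_le hab)]
    exact Real.exp_le_exp.2 (ratePrimitive_mono hRloc ha hab)

theorem survivor_eq (hRloc : LocallyIntegrableOn (fun x => (R x : ℝ)) (Ioi 0)) {z : ℝ}
    (hz : 0 < z) (t : ℝ≥0) :
    survivor R z t =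
      ENNReal.ofReal (Real.exp (ratePrimitive R z - ratePrimitive R (z * Real.exp t))) := by
  have hle : z ≤ z * Real.exp t := by
    have := Real.one_le_exp t.coe_nonneg
    nlinarith
  have hint := intervalIntegrable_rate hRloc hz (hz.trans_le hle)
  have h1 : ∫⁻ u in Ioc z (z * Real.exp t), (R u : ℝ≥0∞) =
      ENNReal.ofReal (ratePrimitive R (z * Real.exp t) - ratePrimitive R z) := by
    rw [ratePrimitive_sub hRloc hz (hz.trans_le hle), intervalIntegral.integral_of_le hle,
      ofReal_integral_eq_lintegral_ofReal]
    · simp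
    · exact (intervalIntegrable_iff_integrableOn_Ioc_of_le hle).1 hint
    · exact Eventually.of_forall fun u => (R u).coe_nonneg
  rw [survivor, h1, EReal.coe_ennreal_ofReal,
    max_eq_left (sub_nonneg.2 (ratePrimitive_mono hRloc hz hle)), ← EReal.coe_neg, EReal.exp_coe,
    neg_sub]

/-- On compact subintervals of `(0, ∞)`, the integrating factor is approximated by solutions of
`v' = h v` with `h` continuous and close to `R` in `L¹`. -/
theorem exists_smooth_weight (hRloc : LocallyIntegrableOn (fun x => (R x : ℝ)) (Ioi 0))
    {a b : ℝ} (ha : 0 < a) (hab : a ≤ b) {ε : ℝ} (hε : 0 < ε) (hε1 : ε ≤ 1) :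
    ∃ v h : ℝ → ℝ, Continuous h ∧ (∀ x, HasDerivAt v (h x * v x) x) ∧
      (∀ x ∈ Ioc a b, |v x - weight R x| ≤ 2 * weight R b * ε) ∧
      (∀ x ∈ Ioc a b, |v x| ≤ 3 * weight R b) ∧
      ∫⁻ x in Ioc a b, ENNReal.ofReal |h x - R x| ≤ ENNReal.ofReal ε := by
  have hint : IntegrableOn (fun x => (R x : ℝ)) (Ioc a b) :=
    (intervalIntegrable_iff_integrableOn_Ioc_of_le hab).1
      (intervalIntegrable_rate hRloc ha (ha.trans_le hab))
  obtain ⟨h, -, hh, hc, hi⟩ := Integrable.exists_hasCompactSupport_integral_sub_le hint hε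
  have hd : Integrable (fun x => |h x - R x|) (volume.restrict (Ioc a b)) := (hi.sub hint).abs
  have hsub : ∫ x in Ioc a b, |h x - R x| ≤ ε := by
    refine le_trans (le_of_eq (integral_congr_ae (Eventually.of_forall fun x => ?_))) hh
    rw [Real.norm_eq_abs, abs_sub_comm]
  have hlip (x : ℝ) (hx : x ∈ Ioc a b) :
      |(∫ u in a..x, h u) - ∫ u in a..x, (R u : ℝ)| ≤ ε := by
    rw [← intervalIntegral.integral_sub (hc.intervalIntegrable _ _)
      (intervalIntegrable_rate hRloc ha (ha.trans hx.1))]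
    refine (intervalIntegral.abs_integral_le_integral_abs hx.1.le).trans ?_
    rw [intervalIntegral.integral_of_le hx.1.le]
    exact (setIntegral_mono_set hd (Eventually.of_forall fun _ => abs_nonneg _)
      (Ioc_subset_Ioc_right hx.2).eventuallyLE).trans hsub
  set v : ℝ → ℝ := fun x => Real.exp (ratePrimitive R a + ∫ u in a..x, h u) with hv
  have hclose (x : ℝ) (hx : x ∈ Ioc a b) : |v x - weight R x| ≤ 2 * weight R b * ε := by
    have hx0 : 0 < x := ha.trans hx.1
    have h1 : v x - weight R x = weight R x *
        (Real.exp ((∫ u in a..x, h u) - ∫ u in a..x, (R u : ℝ)) - 1) := by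
      rw [weight_of_pos hx0, mul_sub, ← Real.exp_add, mul_one, hv,
        ← ratePrimitive_sub hRloc ha hx0]
      congr 2
      ring_nf
    rw [h1, abs_mul, abs_of_nonneg (weight_nonneg x)]
    have h2 := Real.abs_exp_sub_one_le ((hlip x hx).trans hε1)
    have h3 := hlip x hx
    calc _ ≤ weight R b * (2 * ε) :=
          mul_le_mul (weight_mono hRloc hx.2) (h2.trans (by linarith)) (abs_nonneg _)
            (weight_nonneg b)
      _ = _ := by ring
  refine ⟨v, h, hc, fun x => ?_, hclose, fun x hx => ?_, ?_⟩
  · have h1 : HasDerivAt (fun x => ratePrimitive R a + ∫ u in a..x, h u) (h x) x :=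
      (intervalIntegral.integral_hasDerivAt_right (hc.intervalIntegrable _ _)
        hc.stronglyMeasurable.stronglyMeasurableAtFilter hc.continuousAt).const_add _
    convert h1.exp using 1
    rw [mul_comm]
  · have h1 := hclose x hx
    have h2 := weight_mono hRloc hx.2
    have h3 := weight_nonneg (R := R) x
    have h4 := weight_nonneg (R := R) b
    calc |v x| = |(v x - weight R x) + weight R x| := by ring_nf
      _ ≤ |v x - weight R x| + |weight R x| := abs_add_le _ _
      _ ≤ 2 * weight R b * ε + weight R b := by
          rw [abs_of_nonneg h3]
          exact add_le_add h1 h2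
      _ ≤ _ := by nlinarith
  · rw [← ofReal_integral_eq_lintegral_ofReal hd (Eventually.of_forall fun _ => abs_nonneg _)]
    exact ENNReal.ofReal_le_ofReal hsub

end Weight

/-! ### The jump kernel -/

/-- The average `∫_0^1 f(x √v) dv` of `f` over the position after a jump from `x`. -/
noncomputable def jumpAverage (f : ℝ → ℝ) (x : ℝ) : ℝ := ∫ v, f (x * √v) ∂uniform

theorem integral_jump_eq {f : ℝ → ℝ} (hf : Continuous f) {x : ℝ} (hx : 0 < x) :
    ∫ u in (0 : ℝ)..x, 2 * u / x ^ 2 * f u = jumpAverage f x := by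
  have h1 : ∫ w in (0 : ℝ)..1, (fun v => f (x * √v)) (w ^ 2) * (2 * w) =
      ∫ v in (0 : ℝ) ^ 2..1 ^ 2, f (x * √v) :=
    intervalIntegral.integral_comp_mul_deriv (f := fun w => w ^ 2) (g := fun v => f (x * √v))
      (fun w _ => by simpa using hasDerivAt_pow 2 w) (by fun_prop) (by fun_prop)
  have h2 : ∫ w in (0 : ℝ)..1, (fun u => 2 * u / x ^ 2 * f u) (x * w) =
      x⁻¹ • ∫ u in x * 0..x * 1, 2 * u / x ^ 2 * f u :=
    intervalIntegral.integral_comp_mul_left (fun u => 2 * u / x ^ 2 * f u) hx.ne'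
  rw [mul_zero, mul_one] at h2
  rw [jumpAverage, uniform, restrict_Ioo_eq_restrict_Ioc,
    ← intervalIntegral.integral_of_le zero_le_one]
  norm_num at h1
  rw [← h1, show ∫ u in (0 : ℝ)..x, 2 * u / x ^ 2 * f u =
    x * (x⁻¹ • ∫ u in (0 : ℝ)..x, 2 * u / x ^ 2 * f u) by
      rw [smul_eq_mul, mul_inv_cancel_left₀ hx.ne'], ← h2, ← intervalIntegral.integral_const_mul]
  refine intervalIntegral.integral_congr fun w hw => ?_
  rw [uIcc_of_le zero_le_one] at hw
  simp only
  rw [Real.sqrt_sq hw.1]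
  field_simp

theorem generator_eq (R : ℝ → ℝ≥0) {f : ℝ → ℝ} (hf : Continuous f) {x : ℝ} (hx : 0 < x) :
    generator R f x = x * deriv f x + x * R x * (jumpAverage f x - f x) := by
  rw [generator, integral_jump_eq hf hx]

theorem abs_jumpAverage_le {f : ℝ → ℝ} {C : ℝ} (hf : ∀ x, |f x| ≤ C) (x : ℝ) :
    |jumpAverage f x| ≤ C := by
  have := norm_integral_le_of_norm_le_const (μ := uniform) (f := fun v => f (x * √v)) (C := C)
    (Eventually.of_forall fun v => hf (x * √v))
  simpa [jumpAverage] using this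

theorem jumpAverage_sub {f g : ℝ → ℝ} (hf : Measurable f) (hg : Measurable g) {C : ℝ}
    (hfC : ∀ x, |f x| ≤ C) (hgC : ∀ x, |g x| ≤ C) (x : ℝ) :
    jumpAverage f x - jumpAverage g x = jumpAverage (fun y => f y - g y) x := by
  have hi {f : ℝ → ℝ} (hf : Measurable f) (hfC : ∀ x, |f x| ≤ C) :
      Integrable (fun v => f (x * √v)) uniform :=
    Integrable.of_bound (hf.comp (by fun_prop)).aestronglyMeasurable C
      (Eventually.of_forall fun v => hfC _)
  exact (integral_sub (hi hf hfC) (hi hg hgC)).symm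

theorem measurable_jumpAverage {α : Type*} [MeasurableSpace α] {f : α → ℝ → ℝ}
    (hf : Measurable (Function.uncurry f)) :
    Measurable (Function.uncurry fun a => jumpAverage (f a)) := by
  have h : Measurable fun p : (α × ℝ) × ℝ => f p.1.1 (p.1.2 * √p.2) :=
    hf.comp (by fun_prop : Measurable fun p : (α × ℝ) × ℝ => (p.1.1, p.1.2 * √p.2))
  exact (h.stronglyMeasurable.integral_prod_right' (ν := uniform)).measurable

/-! ### Test functions -/

theorem IsTestFunction.exists_bounds {χ : ℝ → ℝ} (hχ : IsTestFunction χ) :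
    ∃ a b C : ℝ, 0 < a ∧ a ≤ b ∧ 0 ≤ C ∧ (∀ x ∉ Ioc a b, χ x = 0 ∧ deriv χ x = 0) ∧
      ∀ x, |χ x| ≤ C ∧ |deriv χ x| ≤ C := by
  have hd : Continuous (deriv χ) := hχ.contDiff.continuous_deriv le_rfl
  obtain ⟨C₁, h₁⟩ := hχ.hasCompactSupport.exists_bound_of_continuous hχ.contDiff.continuous
  obtain ⟨C₂, h₂⟩ := hχ.hasCompactSupport.deriv.exists_bound_of_continuous hd
  have hC : 0 ≤ max C₁ C₂ := ((norm_nonneg _).trans (h₁ 0)).trans (le_max_left _ _)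
  have hCC : ∀ x, |χ x| ≤ max C₁ C₂ ∧ |deriv χ x| ≤ max C₁ C₂ := fun x =>
    ⟨(h₁ x).trans (le_max_left _ _), (h₂ x).trans (le_max_right _ _)⟩
  obtain ⟨a, b, ha, hab, hsub⟩ : ∃ a b : ℝ, 0 < a ∧ a ≤ b ∧ tsupport χ ⊆ Ioc a b := by
    rcases (tsupport χ).eq_empty_or_nonempty with he | hne
    · exact ⟨1, 1, one_pos, le_rfl, by simp [he]⟩
    · obtain ⟨m, hm⟩ := hχ.hasCompactSupport.isCompact.exists_isLeast hne
      obtain ⟨n, hn⟩ := hχ.hasCompactSupport.isCompact.exists_isGreatest hne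
      have hm0 : 0 < m := hχ.tsupport_subset hm.1
      exact ⟨m / 2, n, half_pos hm0, (half_le_self hm0.le).trans (hm.2 hn.1), fun x hx =>
        ⟨(half_lt_self hm0).trans_le (hm.2 hx), hn.2 hx⟩⟩
  refine ⟨a, b, _, ha, hab, hC, fun x hx => ?_, hCC⟩
  have hx' : x ∉ tsupport χ := fun h => hx (hsub h)
  exact ⟨image_eq_zero_of_notMem_tsupport hx',
    Function.notMem_support.1 fun h => hx' (support_deriv_subset h)⟩

theorem IsTestFunction.mul_left {χ v : ℝ → ℝ} (hχ : IsTestFunction χ) (hv : ContDiff ℝ 1 v) :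
    IsTestFunction fun x => v x * χ x where
  contDiff := hv.mul hχ.contDiff
  hasCompactSupport := hχ.hasCompactSupport.mul_left
  tsupport_subset := (tsupport_mul_subset_right (f := v)).trans hχ.tsupport_subset

/-! ### Weak solutions with bounded density -/

/-- A measurable family of probability measures on `(0, ∞)` with locally bounded densities and
uniformly bounded mean jump rate, which solves the Kolmogorov forward equation on test
functions. -/
structure IsBoundedWeakSolution (R : ℝ → ℝ≥0) (M : ℝ≥0) (μ : ℝ≥0 → Measure ℝ) : Prop where
  measurable : Measurable μ
  isProbabilityMeasure : ∀ t, IsProbabilityMeasure (μ t)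
  measure_Iic_zero : ∀ t, μ t (Iic 0) = 0
  lintegral_rate_le : ∀ t, ∫⁻ x, ENNReal.ofReal x * R x ∂(μ t) ≤ M
  restrict_Ioc_le : ∀ a b : ℝ, 0 < a → ∃ C : ℝ≥0, ∀ t,
    (μ t).restrict (Ioc a b) ≤ (C : ℝ≥0∞) • volume.restrict (Ioc a b)
  equation : ∀ f : ℝ → ℝ, IsTestFunction f → ∀ t : ℝ≥0,
    (∫ x, f x ∂(μ t)) - (∫ x, f x ∂(μ 0)) =
      ∫ s in (0 : ℝ)..t, ∫ x, generator R f x ∂(μ s.toNNReal)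

namespace IsBoundedWeakSolution

variable {R : ℝ → ℝ≥0} {M : ℝ≥0} {μ : ℝ≥0 → Measure ℝ}

theorem ae_pos (h : IsBoundedWeakSolution R M μ) (t : ℝ≥0) : ∀ᵐ x ∂(μ t), 0 < x := by
  rw [ae_iff]
  simpa [not_lt, Iic_def] using h.measure_Iic_zero t

/-- The family as a Markov kernel from the time axis. -/
noncomputable def kernel (h : IsBoundedWeakSolution R M μ) : Kernel ℝ ℝ :=
  ⟨fun s => μ s.toNNReal, h.measurable.comp measurable_real_toNNReal⟩

instance (h : IsBoundedWeakSolution R M μ) : IsMarkovKernel h.kernel :=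
  ⟨fun s => h.isProbabilityMeasure s.toNNReal⟩

theorem integrable_of_bound (h : IsBoundedWeakSolution R M μ) (t : ℝ≥0) {g : ℝ → ℝ}
    (hg : Measurable g) {C : ℝ} (hC : ∀ x, |g x| ≤ C) : Integrable g (μ t) := by
  have := h.isProbabilityMeasure t
  exact Integrable.of_bound hg.aestronglyMeasurable C (Eventually.of_forall hC)

theorem abs_integral_le (h : IsBoundedWeakSolution R M μ) (t : ℝ≥0) {g : ℝ → ℝ}
    {C : ℝ} (hC : ∀ x, |g x| ≤ C) : |∫ x, g x ∂(μ t)| ≤ C := by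
  have := h.isProbabilityMeasure t
  simpa using norm_integral_le_of_norm_le_const (μ := μ t) (f := g) (C := C)
    (Eventually.of_forall hC)

theorem integrable_rate (h : IsBoundedWeakSolution R M μ) (hR : Measurable R) (t : ℝ≥0) :
    Integrable (fun x => x * R x) (μ t) := by
  refine ⟨(by fun_prop : Measurable fun x : ℝ => x * (R x : ℝ)).aestronglyMeasurable, ?_⟩
  refine lt_of_le_of_lt ?_ ((h.lintegral_rate_le t).trans_lt ENNReal.coe_lt_top)
  refine lintegral_mono_ae ?_
  filter_upwards [h.ae_pos t] with x hx
  rw [Real.enorm_eq_ofReal (by positivity), ENNReal.ofReal_mul hx.le, ENNReal.ofReal_coe_nnreal]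

theorem integral_rate_le (h : IsBoundedWeakSolution R M μ) (hR : Measurable R) (t : ℝ≥0) :
    ∫ x, x * R x ∂(μ t) ≤ M := by
  rw [integral_eq_lintegral_of_nonneg_ae]
  · refine ENNReal.toReal_le_of_le_ofReal M.coe_nonneg (le_trans (le_of_eq ?_)
      ((h.lintegral_rate_le t).trans (by simp)))
    refine lintegral_congr_ae ?_
    filter_upwards [h.ae_pos t] with x hx
    rw [ENNReal.ofReal_mul hx.le, ENNReal.ofReal_coe_nnreal]
  · filter_upwards [h.ae_pos t] with x hx
    simp only [Pi.zero_apply]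
    positivity
  · exact (by fun_prop : Measurable fun x : ℝ => x * (R x : ℝ)).aestronglyMeasurable

theorem integrable_rate_mul (h : IsBoundedWeakSolution R M μ) (hR : Measurable R) (t : ℝ≥0)
    {k : ℝ → ℝ} (hk : Measurable k) {C : ℝ} (hC : ∀ x, |k x| ≤ C) :
    Integrable (fun x => x * R x * k x) (μ t) :=
  (h.integrable_rate hR t).mul_bdd hk.aestronglyMeasurable (Eventually.of_forall hC)

theorem abs_integral_rate_mul_le (h : IsBoundedWeakSolution R M μ) (hR : Measurable R) (t : ℝ≥0)
    {k : ℝ → ℝ} {C : ℝ} (hC : ∀ x, |k x| ≤ C) :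
    |∫ x, x * R x * k x ∂(μ t)| ≤ M * C := by
  have hC0 : 0 ≤ C := (abs_nonneg _).trans (hC 0)
  calc |∫ x, x * R x * k x ∂(μ t)| ≤ ∫ x, x * R x * C ∂(μ t) := by
        refine norm_integral_le_of_norm_le (f := fun x => x * R x * k x) ((h.integrable_rate hR t).mul_const C) ?_
        filter_upwards [h.ae_pos t] with x hx
        rw [Real.norm_eq_abs, abs_mul, abs_of_nonneg (by positivity : 0 ≤ x * (R x : ℝ))]
        exact mul_le_mul_of_nonneg_left (hC x) (by positivity)
    _ = (∫ x, x * R x ∂(μ t)) * C := integral_mul_const _ _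
    _ ≤ M * C := mul_le_mul_of_nonneg_right (h.integral_rate_le hR t) hC0

theorem measurable_integral (h : IsBoundedWeakSolution R M μ) {g : ℝ → ℝ → ℝ}
    (hg : Measurable (Function.uncurry g)) :
    Measurable fun s : ℝ => ∫ x, g s x ∂(μ s.toNNReal) :=
  (hg.stronglyMeasurable.integral_kernel_prod_right' (κ := h.kernel)).measurable

theorem intervalIntegrable_integral (h : IsBoundedWeakSolution R M μ) {g : ℝ → ℝ → ℝ}
    (hg : Measurable (Function.uncurry g)) {C a b : ℝ}
    (hC : ∀ s ∈ uIoc a b, |∫ x, g s x ∂(μ s.toNNReal)| ≤ C) :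
    IntervalIntegrable (fun s : ℝ => ∫ x, g s x ∂(μ s.toNNReal)) volume a b := by
  refine (intervalIntegrable_const (c := C)).mono_fun
    (h.measurable_integral hg).aestronglyMeasurable ?_
  filter_upwards [ae_restrict_mem measurableSet_uIoc] with s hs
  exact (hC s hs).trans (le_abs_self C)

theorem abs_integral_le_of_abs_le_rate (h : IsBoundedWeakSolution R M μ) (hR : Measurable R)
    {D r : ℝ → ℝ} {a b A B : ℝ} {C : ℝ≥0} {ε : ℝ} (hA : 0 ≤ A) (hB : 0 ≤ B) (hε : 0 ≤ ε)
    (hr : Measurable r)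
    (hC : ∀ t, (μ t).restrict (Ioc a b) ≤ (C : ℝ≥0∞) • volume.restrict (Ioc a b))
    (hrε : ∫⁻ x in Ioc a b, ENNReal.ofReal |r x| ≤ ENNReal.ofReal ε)
    (hD : ∀ x, 0 < x → |D x| ≤ A * ε + (Ioc a b).indicator (fun x => B * |r x|) x +
      x * R x * (A * ε)) (t : ℝ≥0) :
    |∫ x, D x ∂(μ t)| ≤ (A + B * C + M * A) * ε := by
  have := h.isProbabilityMeasure t
  have h1 : ‖∫ x, D x ∂(μ t)‖ₑ ≤ ENNReal.ofReal ((A + B * C + M * A) * ε) := by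
    calc ‖∫ x, D x ∂(μ t)‖ₑ ≤ ∫⁻ x, ‖D x‖ₑ ∂(μ t) := enorm_integral_le_lintegral_enorm _
      _ ≤ ∫⁻ x, (ENNReal.ofReal (A * ε) +
            (Ioc a b).indicator (fun x => ENNReal.ofReal B * ENNReal.ofReal |r x|) x +
            ENNReal.ofReal x * R x * ENNReal.ofReal (A * ε)) ∂(μ t) := by
          refine lintegral_mono_ae ?_
          filter_upwards [h.ae_pos t] with x hx
          rw [Real.enorm_eq_ofReal_abs]
          refine (ENNReal.ofReal_le_ofReal (hD x hx)).trans ?_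
          refine ENNReal.ofReal_add_le.trans (add_le_add (ENNReal.ofReal_add_le.trans
            (add_le_add le_rfl ?_)) ?_)
          · by_cases hxx : x ∈ Ioc a b
            · rw [indicator_of_mem hxx, indicator_of_mem hxx, ENNReal.ofReal_mul hB]
            · simp [indicator_of_notMem hxx]
          · rw [ENNReal.ofReal_mul (by positivity), ENNReal.ofReal_mul hx.le,
              ENNReal.ofReal_coe_nnreal]
      _ = ENNReal.ofReal (A * ε) +
            ENNReal.ofReal B * ∫⁻ x in Ioc a b, ENNReal.ofReal |r x| ∂(μ t) +
            (∫⁻ x, ENNReal.ofReal x * R x ∂(μ t)) * ENNReal.ofReal (A * ε) := by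
          have hm : Measurable fun x => ENNReal.ofReal B * ENNReal.ofReal |r x| := by fun_prop
          rw [lintegral_add_right _ (by fun_prop), lintegral_add_left measurable_const, lintegral_const, measure_univ, mul_one,
            lintegral_indicator measurableSet_Ioc, lintegral_const_mul _ (by fun_prop),
            lintegral_mul_const _ (by fun_prop)]
      _ ≤ ENNReal.ofReal (A * ε) + ENNReal.ofReal B * (C * ENNReal.ofReal ε) +
            M * ENNReal.ofReal (A * ε) := by
          gcongr
          · refine (lintegral_mono' (hC t) le_rfl).trans ?_
            rw [lintegral_smul_measure, smul_eq_mul]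
            gcongr
          · exact h.lintegral_rate_le t
      _ = ENNReal.ofReal ((A + B * C + M * A) * ε) := by
          rw [← ENNReal.ofReal_coe_nnreal (p := C), ← ENNReal.ofReal_coe_nnreal (p := M),
            ← ENNReal.ofReal_mul (by positivity), ← ENNReal.ofReal_mul (by positivity),
            ← ENNReal.ofReal_mul (by positivity), ← ENNReal.ofReal_add (by positivity)
            (by positivity), ← ENNReal.ofReal_add (by positivity) (by positivity)]
          ring_nf
  rw [Real.enorm_eq_ofReal_abs] at h1
  exact (ENNReal.ofReal_le_ofReal_iff (by positivity)).1 h1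

/-- The forward equation holds for products of the integrating factor with test functions. -/
theorem weighted_equation (h : IsBoundedWeakSolution R M μ) (hR : Measurable R)
    (hRloc : LocallyIntegrableOn (fun x => (R x : ℝ)) (Ioi 0)) {χ : ℝ → ℝ}
    (hχ : IsTestFunction χ) (t : ℝ≥0) :
    (∫ x, weight R x * χ x ∂(μ t)) - (∫ x, weight R x * χ x ∂(μ 0)) =
      ∫ s in (0 : ℝ)..t, ∫ x, (weight R x * (x * deriv χ x) +
        x * R x * jumpAverage (fun y => weight R y * χ y) x) ∂(μ s.toNNReal) := by
  obtain ⟨a, b, C, ha, hab, hC0, hout, hbd⟩ := hχ.exists_bounds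
  obtain ⟨C', hC'⟩ := h.restrict_Ioc_le a b ha
  have hb : 0 < b := ha.trans_le hab
  set w := weight R with hw
  set W := weight R b with hWdef
  have hW : 0 ≤ W := weight_nonneg b
  have hwm : Measurable w := measurable_weight hRloc
  have hχc := hχ.contDiff.continuous
  have hχ'c : Continuous (deriv χ) := hχ.contDiff.continuous_deriv le_rfl
  have hwle (x : ℝ) (hx : x ∈ Ioc a b) : |w x| ≤ W := by
    rw [abs_of_nonneg (weight_nonneg x)]
    exact weight_mono hRloc hx.2
  have hwχ (x : ℝ) : |w x * χ x| ≤ 3 * W * C := by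
    by_cases hx : x ∈ Ioc a b
    · rw [abs_mul]
      exact mul_le_mul ((hwle x hx).trans (by linarith)) (hbd x).1 (abs_nonneg _) (by positivity)
    · rw [(hout x hx).1, mul_zero, abs_zero]
      positivity
  have hwχ' (x : ℝ) : |w x * (x * deriv χ x)| ≤ W * (b * C) := by
    by_cases hx : x ∈ Ioc a b
    · rw [abs_mul, abs_mul, abs_of_pos (ha.trans hx.1)]
      exact mul_le_mul (hwle x hx) (mul_le_mul hx.2 (hbd x).2 (abs_nonneg _) hb.le)
        (by have := ha.trans hx.1; positivity) hW
    · rw [(hout x hx).2, mul_zero, mul_zero, abs_zero]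
      positivity
  have hwχm : Measurable fun x => w x * χ x := hwm.mul hχc.measurable
  have hKm : Measurable (jumpAverage fun y => w y * χ y) :=
    (measurable_jumpAverage (α := Unit) (f := fun _ y => w y * χ y)
      (hwχm.comp measurable_snd)).comp (measurable_const.prodMk measurable_id :
        Measurable fun x : ℝ => (((), x) : Unit × ℝ))
  have hKb := abs_jumpAverage_le hwχ
  have hg1m : Measurable fun x => w x * (x * deriv χ x) :=
    hwm.mul (measurable_id.mul hχ'c.measurable)
  have hgm : Measurable fun x => w x * (x * deriv χ x) +
      x * R x * jumpAverage (fun y => w y * χ y) x :=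
    hg1m.add ((by fun_prop : Measurable fun x : ℝ => x * (R x : ℝ)).mul hKm)
  have hgi (s : ℝ≥0) : Integrable (fun x => w x * (x * deriv χ x) +
      x * R x * jumpAverage (fun y => w y * χ y) x) (μ s) :=
    (h.integrable_of_bound s hg1m hwχ').add (h.integrable_rate_mul hR s hKm hKb)
  have hgb (s : ℝ≥0) : |∫ x, (w x * (x * deriv χ x) +
      x * R x * jumpAverage (fun y => w y * χ y) x) ∂(μ s)| ≤
      W * (b * C) + M * (3 * W * C) := by
    rw [integral_add (h.integrable_of_bound s hg1m hwχ') (h.integrable_rate_mul hR s hKm hKb)]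
    exact (abs_add_le _ _).trans (add_le_add (h.abs_integral_le s hwχ')
      (h.abs_integral_rate_mul_le hR s hKb))
  set A := 2 * W * C + 2 * W * C * b with hA
  have hA0 : 0 ≤ A := by positivity
  set Q := A + 3 * W * C * b * C' + M * A with hQ
  have hQ0 : 0 ≤ Q := by positivity
  have key (ε : ℝ) (hε : 0 < ε) (hε1 : ε ≤ 1) :
      |((∫ x, w x * χ x ∂(μ t)) - (∫ x, w x * χ x ∂(μ 0))) -
        ∫ s in (0 : ℝ)..t, ∫ x, (w x * (x * deriv χ x) +
          x * R x * jumpAverage (fun y => w y * χ y) x) ∂(μ s.toNNReal)| ≤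
      (2 * A + Q * t) * ε := by
    obtain ⟨v, r, hrc, hv, hvw, hvb, hre⟩ := exists_smooth_weight hRloc ha hab hε hε1
    have hvc : Continuous v := continuous_iff_continuousAt.2 fun x => (hv x).continuousAt
    have hvd : deriv v = fun x => r x * v x := funext fun x => (hv x).deriv
    have hv1 : ContDiff ℝ 1 v := by
      rw [contDiff_one_iff_deriv, hvd]
      exact ⟨fun x => (hv x).differentiableAt, hrc.mul hvc⟩
    have hf : IsTestFunction fun x => v x * χ x := hχ.mul_left hv1
    have hfb (x : ℝ) : |v x * χ x| ≤ 3 * W * C := by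
      by_cases hx : x ∈ Ioc a b
      · rw [abs_mul]
        exact mul_le_mul (hvb x hx) (hbd x).1 (abs_nonneg _) (by positivity)
      · rw [(hout x hx).1, mul_zero, abs_zero]
        positivity
    have hfm : Measurable fun x => v x * χ x := (hvc.mul hχc).measurable
    have hAε : 2 * W * ε * C ≤ A * ε := by
      rw [hA]
      have : 0 ≤ 2 * W * C * b * ε := by positivity
      nlinarith
    have hAε' : 2 * W * ε * (b * C) ≤ A * ε := by
      rw [hA]
      have : 0 ≤ 2 * W * C * ε := by positivity
      nlinarith
    have hdiff (x : ℝ) : |v x * χ x - w x * χ x| ≤ A * ε := by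
      refine le_trans ?_ hAε
      by_cases hx : x ∈ Ioc a b
      · rw [← sub_mul, abs_mul]
        exact mul_le_mul (hvw x hx) (hbd x).1 (abs_nonneg _) (by positivity)
      · rw [(hout x hx).1, mul_zero, mul_zero, sub_zero, abs_zero]
        positivity
    have hderiv (x : ℝ) : deriv (fun x => v x * χ x) x = r x * v x * χ x + v x * deriv χ x :=
      ((hv x).mul ((hχ.contDiff.differentiable one_ne_zero) x).hasDerivAt).deriv
    have hgenm : Measurable fun x => x * deriv (fun x => v x * χ x) x +
        x * R x * (jumpAverage (fun x => v x * χ x) x - v x * χ x) := by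
      have hKm' : Measurable (jumpAverage fun y => v y * χ y) :=
        (measurable_jumpAverage (α := Unit) (f := fun _ y => v y * χ y)
          (hfm.comp measurable_snd)).comp (measurable_const.prodMk measurable_id :
            Measurable fun x : ℝ => (((), x) : Unit × ℝ))
      exact (measurable_id.mul (measurable_deriv _)).add
        ((by fun_prop : Measurable fun x : ℝ => x * (R x : ℝ)).mul (hKm'.sub hfm))
    have hgen (s : ℝ≥0) : ∫ x, generator R (fun x => v x * χ x) x ∂(μ s) =
        ∫ x, (x * deriv (fun x => v x * χ x) x +
        x * R x * (jumpAverage (fun x => v x * χ x) x - v x * χ x)) ∂(μ s) := by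
      refine integral_congr_ae ?_
      filter_upwards [h.ae_pos s] with x hx
      exact generator_eq R (hvc.mul hχc) hx
    have hdgen (s : ℝ≥0) : |(∫ x, generator R (fun x => v x * χ x) x ∂(μ s)) -
        ∫ x, (w x * (x * deriv χ x) +
          x * R x * jumpAverage (fun y => w y * χ y) x) ∂(μ s)| ≤ Q * ε := by
      have hgeni : Integrable (fun x => x * deriv (fun x => v x * χ x) x +
          x * R x * (jumpAverage (fun x => v x * χ x) x - v x * χ x)) (μ s) := by
        obtain ⟨Cf, hCf⟩ := hf.hasCompactSupport.deriv.exists_bound_of_continuous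
          (hf.contDiff.continuous_deriv le_rfl)
        have hCf0 : 0 ≤ Cf := (norm_nonneg _).trans (hCf 0)
        have hKm' : Measurable (jumpAverage fun y => v y * χ y) :=
          (measurable_jumpAverage (α := Unit) (f := fun _ y => v y * χ y)
            (hfm.comp measurable_snd)).comp (measurable_const.prodMk measurable_id :
              Measurable fun x : ℝ => (((), x) : Unit × ℝ))
        refine Integrable.add (h.integrable_of_bound s
          (measurable_id.mul (measurable_deriv _)) (C := b * Cf) fun x => ?_)
          (h.integrable_rate_mul hR s (hKm'.sub hfm)
            (C := 3 * W * C + 3 * W * C) fun x => ?_)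
        · by_cases hx : x ∈ Ioc a b
          · rw [abs_mul, abs_of_pos (ha.trans hx.1)]
            exact mul_le_mul hx.2 (hCf x) (abs_nonneg _) hb.le
          · rw [hderiv, (hout x hx).1, (hout x hx).2]
            simp only [mul_zero, add_zero, abs_zero]
            positivity
        · exact (abs_sub _ _).trans (add_le_add (abs_jumpAverage_le hfb x) (hfb x))
      rw [hgen, ← integral_sub hgeni (hgi s)]
      refine h.abs_integral_le_of_abs_le_rate hR (r := fun x => r x - R x) hA0
        (by positivity : 0 ≤ 3 * W * C * b) hε.le (by fun_prop) hC' hre (fun x hx => ?_) s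
      have hid : x * deriv (fun x => v x * χ x) x +
          x * R x * (jumpAverage (fun x => v x * χ x) x - v x * χ x) -
          (w x * (x * deriv χ x) + x * R x * jumpAverage (fun y => w y * χ y) x) =
          (v x - w x) * (x * deriv χ x) + x * (v x * χ x) * (r x - R x) +
          x * R x * jumpAverage (fun y => v y * χ y - w y * χ y) x := by
        rw [← jumpAverage_sub hfm hwχm hfb hwχ, hderiv]
        ring
      rw [hid]
      refine (abs_add_le _ _).trans (add_le_add ((abs_add_le _ _).trans (add_le_add ?_ ?_)) ?_)
      · refine le_trans ?_ hAε'
        by_cases hxx : x ∈ Ioc a b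
        · rw [abs_mul, abs_mul, abs_of_pos hx]
          exact mul_le_mul (hvw x hxx) (mul_le_mul hxx.2 (hbd x).2 (abs_nonneg _) hb.le)
            (by positivity) (by positivity)
        · rw [(hout x hxx).2, mul_zero, mul_zero, abs_zero]
          positivity
      · by_cases hxx : x ∈ Ioc a b
        · rw [indicator_of_mem hxx, abs_mul, abs_mul, abs_of_pos hx]
          refine mul_le_mul_of_nonneg_right ?_ (abs_nonneg _)
          calc x * |v x * χ x| ≤ b * (3 * W * C) :=
                mul_le_mul hxx.2 (hfb x) (abs_nonneg _) hb.le
            _ = 3 * W * C * b := by ring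
        · rw [indicator_of_notMem hxx, (hout x hxx).1, mul_zero, mul_zero, zero_mul, abs_zero]
      · rw [abs_mul, abs_of_nonneg (by positivity : 0 ≤ x * (R x : ℝ))]
        exact mul_le_mul_of_nonneg_left (abs_jumpAverage_le hdiff x) (by positivity)
    have heq := h.equation _ hf t
    have hI (s : ℝ≥0) : |(∫ x, v x * χ x ∂(μ s)) - ∫ x, w x * χ x ∂(μ s)| ≤ A * ε := by
      rw [← integral_sub (h.integrable_of_bound s hfm hfb) (h.integrable_of_bound s hwχm hwχ)]
      exact h.abs_integral_le s hdiff
    have hii1 := h.intervalIntegrable_integral (g := fun _ x => w x * (x * deriv χ x) +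
      x * R x * jumpAverage (fun y => w y * χ y) x) (hgm.comp measurable_snd)
      (fun s _ => hgb s.toNNReal) (a := 0) (b := t)
    have hii2 : IntervalIntegrable (fun s : ℝ =>
        ∫ x, generator R (fun x => v x * χ x) x ∂(μ s.toNNReal)) volume 0 t := by
      have h2 : (fun s : ℝ => ∫ x, generator R (fun x => v x * χ x) x ∂(μ s.toNNReal)) =
          fun s : ℝ => ∫ x, (x * deriv (fun x => v x * χ x) x +
            x * R x * (jumpAverage (fun x => v x * χ x) x - v x * χ x)) ∂(μ s.toNNReal) :=
        funext fun s => hgen _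
      rw [h2]
      refine h.intervalIntegrable_integral (g := fun _ x => x * deriv (fun x => v x * χ x) x +
        x * R x * (jumpAverage (fun x => v x * χ x) x - v x * χ x))
        (hgenm.comp measurable_snd) (C := Q * ε + (W * (b * C) + M * (3 * W * C)))
        (fun s _ => ?_)
      rw [← hgen]
      have h3 := (abs_sub_abs_le_abs_sub _ _).trans (hdgen s.toNNReal)
      linarith [hgb s.toNNReal]
    have hint : |(∫ s in (0 : ℝ)..t, ∫ x, generator R (fun x => v x * χ x) x ∂(μ s.toNNReal)) -
        ∫ s in (0 : ℝ)..t, ∫ x, (w x * (x * deriv χ x) +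
          x * R x * jumpAverage (fun y => w y * χ y) x) ∂(μ s.toNNReal)| ≤ Q * ε * t := by
      rw [← intervalIntegral.integral_sub hii2 hii1]
      have := intervalIntegral.norm_integral_le_of_norm_le_const (a := 0) (b := (t : ℝ))
        (C := Q * ε) (f := fun s : ℝ => (∫ x, generator R (fun x => v x * χ x) x ∂(μ s.toNNReal)) -
          ∫ x, (w x * (x * deriv χ x) +
            x * R x * jumpAverage (fun y => w y * χ y) x) ∂(μ s.toNNReal))
        (fun s _ => hdgen s.toNNReal)
      simpa using this
    have h1 := abs_le.1 (hI t)
    have h2 := abs_le.1 (hI 0)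
    have h3 := abs_le.1 hint
    rw [abs_le]
    constructor <;> linarith
  by_contra hne
  have hpos : 0 < |((∫ x, w x * χ x ∂(μ t)) - (∫ x, w x * χ x ∂(μ 0))) -
        ∫ s in (0 : ℝ)..t, ∫ x, (w x * (x * deriv χ x) +
          x * R x * jumpAverage (fun y => w y * χ y) x) ∂(μ s.toNNReal)| :=
    abs_pos.2 (sub_ne_zero.2 hne)
  set δ := |((∫ x, w x * χ x ∂(μ t)) - (∫ x, w x * χ x ∂(μ 0))) -
        ∫ s in (0 : ℝ)..t, ∫ x, (w x * (x * deriv χ x) +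
          x * R x * jumpAverage (fun y => w y * χ y) x) ∂(μ s.toNNReal)| with hδ
  have hP : 0 ≤ 2 * A + Q * t := by positivity
  have hk := key (min 1 (δ / (2 * (2 * A + Q * t + 1)))) (lt_min one_pos (by positivity))
    (min_le_left _ _)
  have h4 : (2 * A + Q * t) * min 1 (δ / (2 * (2 * A + Q * t + 1))) ≤
      (2 * A + Q * t) * (δ / (2 * (2 * A + Q * t + 1))) :=
    mul_le_mul_of_nonneg_left (min_le_right _ _) hP
  have h5 : (2 * A + Q * t) * (δ / (2 * (2 * A + Q * t + 1))) < δ := by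
    rw [mul_div_assoc', div_lt_iff₀ (by positivity)]
    nlinarith
  linarith

end IsBoundedWeakSolution

/-! ### Two mean value estimates -/

theorem abs_sub_le_of_hasDerivAt {f f' : ℝ → ℝ} {a b C : ℝ} (hab : a ≤ b)
    (hf : ∀ r, HasDerivAt f (f' r) r) (hC : ∀ r ∈ Icc a b, |f' r| ≤ C) :
    |f b - f a| ≤ C * (b - a) := by
  have h := (convex_Icc a b).norm_image_sub_le_of_norm_hasDerivWithin_le (f := f) (f' := f')
    (C := C) (fun r _ => (hf r).hasDerivWithinAt) hC (left_mem_Icc.2 hab) (right_mem_Icc.2 hab)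
  simpa [Real.norm_eq_abs, abs_of_nonneg (sub_nonneg.2 hab)] using h

theorem abs_sub_sub_mul_le_of_hasDerivAt {f f' f'' : ℝ → ℝ} {a b C : ℝ} (hab : a ≤ b)
    (hf : ∀ r, HasDerivAt f (f' r) r) (hf' : ∀ r, HasDerivAt f' (f'' r) r)
    (hC : ∀ r ∈ Icc a b, |f'' r| ≤ C) :
    |f b - f a - (b - a) * f' a| ≤ C * (b - a) ^ 2 := by
  have hC0 : 0 ≤ C := (abs_nonneg _).trans (hC a (left_mem_Icc.2 hab))
  have h := abs_sub_le_of_hasDerivAt (f := fun r => f r - r * f' a) (f' := fun r => f' r - f' a)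
    (C := C * (b - a)) hab
    (fun r => by simpa using (hf r).fun_sub ((hasDerivAt_id r).mul_const (f' a))) fun r hr =>
      (abs_sub_le_of_hasDerivAt hr.1 hf' fun q hq => hC q ⟨hq.1, hq.2.trans hr.2⟩).trans
        (mul_le_mul_of_nonneg_left (by linarith [hr.2]) hC0)
  calc |f b - f a - (b - a) * f' a| = |f b - b * f' a - (f a - a * f' a)| := by ring_nf
    _ ≤ C * (b - a) * (b - a) := h
    _ = _ := by ring

theorem eq_of_abs_sub_le_sq {F : ℝ → ℝ} {t C : ℝ} (ht : 0 ≤ t)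
    (hF : ∀ a b, 0 ≤ a → a ≤ b → b ≤ t → |F b - F a| ≤ C * (b - a) ^ 2) : F t = F 0 := by
  have hstep (n : ℕ) (hn : 0 < n) (i : ℕ) (hi : i ≤ n) :
      |F (i * (t / n)) - F 0| ≤ i * (C * (t / n) ^ 2) := by
    have hn' : (0 : ℝ) < n := by exact_mod_cast hn
    induction i with
    | zero => simp
    | succ i ih =>
      have h1 := ih (by omega)
      have hle : (((i + 1 : ℕ) : ℝ)) * (t / n) ≤ t := by
        have : ((i + 1 : ℕ) : ℝ) ≤ n := by exact_mod_cast hi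
        calc _ ≤ (n : ℝ) * (t / n) := mul_le_mul_of_nonneg_right this (by positivity)
          _ = t := by field_simp
      have h2 := hF (i * (t / n)) ((i + 1 : ℕ) * (t / n)) (by positivity)
        (mul_le_mul_of_nonneg_right (by push_cast; linarith) (by positivity)) hle
      calc |F ((i + 1 : ℕ) * (t / n)) - F 0|
          ≤ |F ((i + 1 : ℕ) * (t / n)) - F (i * (t / n))| + |F (i * (t / n)) - F 0| :=
            abs_sub_le _ _ _
        _ ≤ C * (((i + 1 : ℕ) : ℝ) * (t / n) - i * (t / n)) ^ 2 + i * (C * (t / n) ^ 2) :=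
            add_le_add h2 h1
        _ = _ := by push_cast; ring
  have hlim : Tendsto (fun n : ℕ => C * t ^ 2 * (1 / ((n : ℝ) + 1))) atTop (nhds (C * t ^ 2 * 0)) :=
    tendsto_one_div_add_atTop_nhds_zero_nat.const_mul _
  have hle : |F t - F 0| ≤ C * t ^ 2 * 0 := by
    refine ge_of_tendsto' hlim fun n => ?_
    have hn : ((n + 1 : ℕ) : ℝ) ≠ 0 := by positivity
    have h := hstep (n + 1) n.succ_pos (n + 1) le_rfl
    rw [mul_div_cancel₀ _ hn] at h
    refine h.trans (le_of_eq ?_)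
    push_cast at hn ⊢
    field_simp
  rw [mul_zero] at hle
  exact sub_eq_zero.1 (abs_nonpos_iff.1 hle)

/-! ### Smooth test functions and dilations -/

/-- `f ∈ C_c^∞(0, ∞)`, extended by zero to `ℝ`. -/
structure IsSmoothTestFunction (f : ℝ → ℝ) : Prop where
  contDiff : ContDiff ℝ ((⊤ : ℕ∞) : WithTop ℕ∞) f
  hasCompactSupport : HasCompactSupport f
  tsupport_subset : tsupport f ⊆ Ioi 0

/-- The Euler operator `x f'(x)`. -/
noncomputable def euler (f : ℝ → ℝ) (x : ℝ) : ℝ := x * deriv f x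

namespace IsSmoothTestFunction

variable {ψ : ℝ → ℝ}

theorem euler (hψ : IsSmoothTestFunction ψ) : IsSmoothTestFunction (euler ψ) where
  contDiff := contDiff_id.mul ((contDiff_infty_iff_deriv.1 hψ.contDiff).2)
  hasCompactSupport := hψ.hasCompactSupport.deriv.mul_left
  tsupport_subset := (tsupport_mul_subset_right (f := fun x : ℝ => x)).trans
    ((tsupport_deriv_subset).trans hψ.tsupport_subset)

theorem isTestFunction_dilate (hψ : IsSmoothTestFunction ψ) (r : ℝ) :
    IsTestFunction fun x => ψ (x * Real.exp r) where
  contDiff := (hψ.contDiff.of_le (by simp)).comp (contDiff_id.mul contDiff_const)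
  hasCompactSupport :=
    hψ.hasCompactSupport.comp_homeomorph (Homeomorph.mulRight₀ _ (Real.exp_pos r).ne')
  tsupport_subset := fun x hx => by
    have h := hψ.tsupport_subset (tsupport_comp_subset_preimage ψ
      (f := fun x : ℝ => x * Real.exp r) (by fun_prop) hx)
    exact pos_of_mul_pos_left h (Real.exp_pos r).le

theorem hasDerivAt_dilate (hψ : IsSmoothTestFunction ψ) (x r : ℝ) :
    HasDerivAt (fun r => ψ (x * Real.exp r)) (CellProcess.euler ψ (x * Real.exp r)) r := by
  have h1 : HasDerivAt (fun r => x * Real.exp r) (x * Real.exp r) r :=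
    (Real.hasDerivAt_exp r).const_mul x
  have h2 := ((hψ.contDiff.differentiable (by simp)) (x * Real.exp r)).hasDerivAt.comp r h1
  rwa [mul_comm] at h2

theorem mul_deriv_dilate (hψ : IsSmoothTestFunction ψ) (x r : ℝ) :
    x * deriv (fun x => ψ (x * Real.exp r)) x = CellProcess.euler ψ (x * Real.exp r) := by
  have h1 : HasDerivAt (fun x => x * Real.exp r) (1 * Real.exp r) x :=
    (hasDerivAt_id x).mul_const _
  have h2 := ((hψ.contDiff.differentiable (by simp)) (x * Real.exp r)).hasDerivAt.comp x h1
  have h3 : deriv (fun x => ψ (x * Real.exp r)) x = deriv ψ (x * Real.exp r) * (1 * Real.exp r) :=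
    h2.deriv
  rw [h3, CellProcess.euler]
  ring

theorem exists_weight_bound {R : ℝ → ℝ≥0}
    (hRloc : LocallyIntegrableOn (fun x => (R x : ℝ)) (Ioi 0)) (hψ : IsSmoothTestFunction ψ) :
    ∃ C, ∀ r, 0 ≤ r → ∀ x, |weight R x * ψ (x * Real.exp r)| ≤ C := by
  obtain ⟨a, b, C, ha, hab, hC0, hout, hbd⟩ := (hψ.isTestFunction_dilate 0).exists_bounds
  simp only [Real.exp_zero, mul_one] at hout hbd
  refine ⟨weight R b * C, fun r hr x => ?_⟩
  rcases le_or_gt x 0 with hx | hx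
  · rw [weight_of_nonpos hx, zero_mul, abs_zero]
    exact mul_nonneg (weight_nonneg b) hC0
  by_cases hxb : x * Real.exp r ∈ Ioc a b
  · rw [abs_mul, abs_of_nonneg (weight_nonneg x)]
    have hxle : x ≤ x * Real.exp r := le_mul_of_one_le_right hx.le (Real.one_le_exp hr)
    exact mul_le_mul (weight_mono hRloc (hxle.trans hxb.2)) (hbd _).1 (abs_nonneg _)
      (weight_nonneg b)
  · rw [(hout _ hxb).1, mul_zero, abs_zero]
    exact mul_nonneg (weight_nonneg b) hC0

end IsSmoothTestFunction

namespace IsBoundedWeakSolution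

variable {R : ℝ → ℝ≥0} {M : ℝ≥0} {μ : ℝ≥0 → Measure ℝ}

theorem measurable_weight_mul_dilate (hRloc : LocallyIntegrableOn (fun x => (R x : ℝ)) (Ioi 0))
    {ψ : ℝ → ℝ} (hψ : IsSmoothTestFunction ψ) {ρ : ℝ → ℝ} (hρ : Measurable ρ) :
    Measurable (Function.uncurry fun s x => weight R x * ψ (x * Real.exp (ρ s))) := by
  have h1 := hψ.contDiff.continuous.measurable
  have h2 := measurable_weight hRloc
  simp only [Function.uncurry_def]
  exact (h2.comp measurable_snd).mul (h1.comp (by fun_prop))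

theorem measurable_rate_mul_jumpAverage
    (hR : Measurable R) (hRloc : LocallyIntegrableOn (fun x => (R x : ℝ)) (Ioi 0))
    {ψ : ℝ → ℝ} (hψ : IsSmoothTestFunction ψ) {ρ : ℝ → ℝ} (hρ : Measurable ρ) :
    Measurable (Function.uncurry fun s x => x * R x *
      jumpAverage (fun y => weight R y * ψ (y * Real.exp (ρ s))) x) := by
  have h1 := measurable_jumpAverage (measurable_weight_mul_dilate hRloc hψ hρ)
  simp only [Function.uncurry_def] at h1 ⊢
  exact Measurable.mul (by fun_prop) h1

theorem transport_equation (h : IsBoundedWeakSolution R M μ) (hR : Measurable R)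
    (hRloc : LocallyIntegrableOn (fun x => (R x : ℝ)) (Ioi 0)) {ψ : ℝ → ℝ}
    (hψ : IsSmoothTestFunction ψ) {r : ℝ} (hr : 0 ≤ r) {a b : ℝ} (ha : 0 ≤ a) (hab : a ≤ b) :
    (∫ x, weight R x * ψ (x * Real.exp r) ∂(μ b.toNNReal)) -
        (∫ x, weight R x * ψ (x * Real.exp r) ∂(μ a.toNNReal)) =
      ∫ q in a..b, ((∫ x, weight R x * euler ψ (x * Real.exp r) ∂(μ q.toNNReal)) +
        ∫ x, x * R x * jumpAverage (fun y => weight R y * ψ (y * Real.exp r)) x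
          ∂(μ q.toNNReal)) := by
  obtain ⟨C₀, hC₀⟩ := hψ.exists_weight_bound hRloc
  obtain ⟨C₁, hC₁⟩ := hψ.euler.exists_weight_bound hRloc
  have hm0 := measurable_weight_mul_dilate hRloc hψ (measurable_const (a := r))
  have hm1 := measurable_weight_mul_dilate hRloc hψ.euler (measurable_const (a := r))
  have hm2 := measurable_rate_mul_jumpAverage hR hRloc hψ (measurable_const (a := r))
  have hK : Measurable (jumpAverage fun y => weight R y * ψ (y * Real.exp r)) :=
    (measurable_jumpAverage hm0).comp (measurable_const.prodMk measurable_id :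
        Measurable fun x : ℝ => (((0 : ℝ), x)))
  have hm1' : Measurable fun x => weight R x * euler ψ (x * Real.exp r) :=
    hm1.comp (measurable_const.prodMk measurable_id : Measurable fun x : ℝ => (((0 : ℝ), x)))
  have hint (c d : ℝ) : IntervalIntegrable (fun q : ℝ =>
      (∫ x, weight R x * euler ψ (x * Real.exp r) ∂(μ q.toNNReal)) +
        ∫ x, x * R x * jumpAverage (fun y => weight R y * ψ (y * Real.exp r)) x
          ∂(μ q.toNNReal)) volume c d :=
    (h.intervalIntegrable_integral hm1 (C := C₁) fun s _ =>
      h.abs_integral_le _ (hC₁ r hr)).add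
    (h.intervalIntegrable_integral hm2 (C := M * C₀) fun s _ =>
      h.abs_integral_rate_mul_le hR _ (abs_jumpAverage_le (hC₀ r hr)))
  have hzero (c : ℝ) (hc : 0 ≤ c) :
      (∫ x, weight R x * ψ (x * Real.exp r) ∂(μ c.toNNReal)) -
        (∫ x, weight R x * ψ (x * Real.exp r) ∂(μ 0)) =
      ∫ q in (0 : ℝ)..c, ((∫ x, weight R x * euler ψ (x * Real.exp r) ∂(μ q.toNNReal)) +
        ∫ x, x * R x * jumpAverage (fun y => weight R y * ψ (y * Real.exp r)) x
          ∂(μ q.toNNReal)) := by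
    have := h.weighted_equation hR hRloc (hψ.isTestFunction_dilate r) c.toNNReal
    rw [Real.coe_toNNReal c hc] at this
    rw [this]
    refine intervalIntegral.integral_congr fun s _ => ?_
    simp only [hψ.mul_deriv_dilate]
    exact integral_add (h.integrable_of_bound _ hm1' (hC₁ r hr))
      (h.integrable_rate_mul hR _ hK (abs_jumpAverage_le (hC₀ r hr)))
  rw [← intervalIntegral.integral_interval_sub_left (hint 0 b) (hint 0 a), ← hzero a ha,
    ← hzero b (ha.trans hab)]
  ring

/-- Duhamel's formula: between jumps the process is transported along `x ↦ x e^t`. -/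
theorem duhamel (h : IsBoundedWeakSolution R M μ) (hR : Measurable R)
    (hRloc : LocallyIntegrableOn (fun x => (R x : ℝ)) (Ioi 0)) {ψ : ℝ → ℝ}
    (hψ : IsSmoothTestFunction ψ) {t : ℝ} (ht : 0 ≤ t) :
    ∫ x, weight R x * ψ x ∂(μ t.toNNReal) =
      (∫ x, weight R x * ψ (x * Real.exp t) ∂(μ 0)) +
      ∫ s in (0 : ℝ)..t, ∫ x, x * R x *
        jumpAverage (fun y => weight R y * ψ (y * Real.exp (t - s))) x ∂(μ s.toNNReal) := by
  obtain ⟨C₀, hC₀⟩ := hψ.exists_weight_bound hRloc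
  obtain ⟨C₁, hC₁⟩ := hψ.euler.exists_weight_bound hRloc
  obtain ⟨C₂, hC₂⟩ := hψ.euler.euler.exists_weight_bound hRloc
  have hC₁0 : 0 ≤ C₁ := (abs_nonneg _).trans (hC₁ 0 le_rfl 0)
  have hC₂0 : 0 ≤ C₂ := (abs_nonneg _).trans (hC₂ 0 le_rfl 0)
  have hsec {φ : ℝ → ℝ} (hφ : IsSmoothTestFunction φ) (r : ℝ) :
      Measurable fun x => weight R x * φ (x * Real.exp r) :=
    (measurable_weight_mul_dilate hRloc hφ (measurable_const (a := r))).comp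
      (measurable_const.prodMk measurable_id : Measurable fun x : ℝ => (((0 : ℝ), x)))
  have hder {φ : ℝ → ℝ} (hφ : IsSmoothTestFunction φ) (x r : ℝ) :
      HasDerivAt (fun r => weight R x * φ (x * Real.exp r))
        (weight R x * euler φ (x * Real.exp r)) r := (hφ.hasDerivAt_dilate x r).const_mul _
  set u : (ℝ → ℝ) → ℝ → ℝ → ℝ := fun φ q r =>
    ∫ x, weight R x * φ (x * Real.exp r) ∂(μ q.toNNReal) with hu
  set e : (ℝ → ℝ) → ℝ → ℝ → ℝ := fun φ q r =>
    ∫ x, x * R x * jumpAverage (fun y => weight R y * φ (y * Real.exp r)) x ∂(μ q.toNNReal)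
    with he
  have hKm {φ : ℝ → ℝ} (hφ : Measurable φ) : Measurable (jumpAverage φ) :=
    (measurable_jumpAverage (α := Unit) (f := fun _ => φ) (hφ.comp measurable_snd)).comp
      (measurable_const.prodMk measurable_id : Measurable fun x : ℝ => (((), x) : Unit × ℝ))
  have hebd {φ : ℝ → ℝ} {C : ℝ} (hC : ∀ r, 0 ≤ r → ∀ x, |weight R x * φ (x * Real.exp r)| ≤ C)
      (q r : ℝ) (hr : 0 ≤ r) : |e φ q r| ≤ M * C :=
    h.abs_integral_rate_mul_le hR _ (abs_jumpAverage_le (hC r hr))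
  have hdiag (a b : ℝ) (hat : a ≤ t) (hbt : b ≤ t) :
      IntervalIntegrable (fun q => e ψ q (t - q)) volume a b :=
    h.intervalIntegrable_integral (measurable_rate_mul_jumpAverage hR hRloc hψ
      (measurable_const.sub measurable_id : Measurable fun q : ℝ => t - q)) (C := M * C₀)
      fun s hs => hebd hC₀ s _ (sub_nonneg.2 (hs.2.trans (max_le hat hbt)))
  have hrow {φ : ℝ → ℝ} (hφ : IsSmoothTestFunction φ) {C : ℝ}
      (hC : ∀ r, 0 ≤ r → ∀ x, |weight R x * φ (x * Real.exp r)| ≤ C) (r : ℝ) (hr : 0 ≤ r)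
      (a b : ℝ) : IntervalIntegrable (fun q => u φ q r) volume a b ∧
        IntervalIntegrable (fun q => e φ q r) volume a b :=
    ⟨h.intervalIntegrable_integral (measurable_weight_mul_dilate hRloc hφ measurable_const)
      fun s _ => h.abs_integral_le _ (hC r hr),
     h.intervalIntegrable_integral (measurable_rate_mul_jumpAverage hR hRloc hφ measurable_const)
      fun s _ => hebd hC s r hr⟩
  have hLip (a q r : ℝ) (ha : 0 ≤ a) (haq : a ≤ q) (hr : 0 ≤ r) :
      |u (euler ψ) q r - u (euler ψ) a r| ≤ (C₂ + M * C₁) * (q - a) := by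
    have h1 : u (euler ψ) q r - u (euler ψ) a r =
        ∫ q in a..q, (u (euler (euler ψ)) q r + e (euler ψ) q r) :=
      h.transport_equation hR hRloc hψ.euler hr ha haq
    have h2 := intervalIntegral.norm_integral_le_of_norm_le_const (a := a) (b := q)
      (f := fun q => u (euler (euler ψ)) q r + e (euler ψ) q r) (C := C₂ + M * C₁)
      fun s _ => (norm_add_le _ _).trans (add_le_add (h.abs_integral_le _ (hC₂ r hr))
        (hebd hC₁ s r hr))
    rw [abs_of_nonneg (sub_nonneg.2 haq)] at h2
    rw [h1]
    exact h2
  have hLip' (q r r' : ℝ) (hr : 0 ≤ r) (hrr : r ≤ r') :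
      |e ψ q r - e ψ q r'| ≤ M * (C₁ * (r' - r)) := by
    have hpt (x : ℝ) : |weight R x * ψ (x * Real.exp r) - weight R x * ψ (x * Real.exp r')| ≤
        C₁ * (r' - r) := by
      rw [abs_sub_comm]
      exact abs_sub_le_of_hasDerivAt hrr (hder hψ x) fun s hs => hC₁ s (hr.trans hs.1) x
    have h1 : e ψ q r - e ψ q r' = ∫ x, x * R x * jumpAverage (fun y =>
        weight R y * ψ (y * Real.exp r) - weight R y * ψ (y * Real.exp r')) x
          ∂(μ q.toNNReal) := by
      simp only [he]
      rw [← integral_sub (h.integrable_rate_mul hR _ (hKm (hsec hψ r))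
        (abs_jumpAverage_le (hC₀ r hr))) (h.integrable_rate_mul hR _ (hKm (hsec hψ r'))
        (abs_jumpAverage_le (hC₀ r' (hr.trans hrr))))]
      refine integral_congr_ae (Eventually.of_forall fun x => ?_)
      simp only
      rw [← jumpAverage_sub (hsec hψ r) (hsec hψ r') (hC₀ r hr) (hC₀ r' (hr.trans hrr)), mul_sub]
    rw [h1]
    exact h.abs_integral_rate_mul_le hR _ (abs_jumpAverage_le hpt)
  have htay (q r r' : ℝ) (hr : 0 ≤ r) (hrr : r ≤ r') :
      |u ψ q r' - u ψ q r - (r' - r) * u (euler ψ) q r| ≤ C₂ * (r' - r) ^ 2 := by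
    have i1 := h.integrable_of_bound q.toNNReal (hsec hψ r') (hC₀ r' (hr.trans hrr))
    have i2 := h.integrable_of_bound q.toNNReal (hsec hψ r) (hC₀ r hr)
    have i3 := (h.integrable_of_bound q.toNNReal (hsec hψ.euler r) (hC₁ r hr)).const_mul (r' - r)
    have i4 : Integrable (fun x => weight R x * ψ (x * Real.exp r') -
      weight R x * ψ (x * Real.exp r)) (μ q.toNNReal) := i1.sub i2
    simp only [hu]
    rw [← integral_const_mul, ← integral_sub i1 i2, ← integral_sub i4 i3]
    exact h.abs_integral_le _ fun x => abs_sub_sub_mul_le_of_hasDerivAt hrr (hder hψ x)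
      (hder hψ.euler x) fun s hs => hC₂ s (hr.trans hs.1) x
  have hF := eq_of_abs_sub_le_sq (F := fun s => u ψ s (t - s) - ∫ q in (0 : ℝ)..s, e ψ q (t - q))
    (C := (C₂ + M * C₁) + M * C₁ + C₂) ht fun a b ha hab hbt => by
      have hr : 0 ≤ t - b := sub_nonneg.2 hbt
      have h1 : u ψ b (t - b) - u ψ a (t - b) =
          ∫ q in a..b, (u (euler ψ) q (t - b) + e ψ q (t - b)) :=
        h.transport_equation hR hRloc hψ hr ha hab
      have h2 := htay a (t - b) (t - a) hr (by linarith)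
      have h3 : (∫ q in (0 : ℝ)..b, e ψ q (t - q)) - ∫ q in (0 : ℝ)..a, e ψ q (t - q) =
          ∫ q in a..b, e ψ q (t - q) :=
        intervalIntegral.integral_interval_sub_left (hdiag 0 b ht hbt)
          (hdiag 0 a ht (hab.trans hbt))
      have h4 : |∫ q in a..b, ((u (euler ψ) q (t - b) + e ψ q (t - b)) - e ψ q (t - q) -
          u (euler ψ) a (t - b))| ≤ ((C₂ + M * C₁) * (b - a) + M * (C₁ * (b - a))) * (b - a) := by
        have := intervalIntegral.norm_integral_le_of_norm_le_const (a := a) (b := b)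
          (f := fun q => (u (euler ψ) q (t - b) + e ψ q (t - b)) - e ψ q (t - q) -
            u (euler ψ) a (t - b)) (C := (C₂ + M * C₁) * (b - a) + M * (C₁ * (b - a)))
          fun q hq => by
            rw [uIoc_of_le hab] at hq
            have e1 := hLip a q (t - b) ha hq.1.le hr
            have e2 := hLip' q (t - b) (t - q) hr (by linarith [hq.2])
            have e3 : (C₂ + M * C₁) * (q - a) ≤ (C₂ + M * C₁) * (b - a) :=
              mul_le_mul_of_nonneg_left (by linarith [hq.2]) (by positivity)
            have e4 : M * (C₁ * (t - q - (t - b))) ≤ M * (C₁ * (b - a)) :=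
              mul_le_mul_of_nonneg_left (mul_le_mul_of_nonneg_left (by linarith [hq.1]) hC₁0)
                M.coe_nonneg
            calc ‖(u (euler ψ) q (t - b) + e ψ q (t - b)) - e ψ q (t - q) -
                  u (euler ψ) a (t - b)‖
                = |(u (euler ψ) q (t - b) - u (euler ψ) a (t - b)) +
                  (e ψ q (t - b) - e ψ q (t - q))| := by
                    rw [Real.norm_eq_abs]
                    congr 1
                    ring
              _ ≤ _ := (abs_add_le _ _).trans (add_le_add (e1.trans e3) (e2.trans e4))
        rwa [abs_of_nonneg (sub_nonneg.2 hab)] at this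
      have h5 : ∫ q in a..b, ((u (euler ψ) q (t - b) + e ψ q (t - b)) - e ψ q (t - q) -
          u (euler ψ) a (t - b)) = (∫ q in a..b, (u (euler ψ) q (t - b) + e ψ q (t - b))) -
            (∫ q in a..b, e ψ q (t - q)) - (b - a) * u (euler ψ) a (t - b) := by
        have i1 := (hrow hψ.euler hC₁ (t - b) hr a b).1.add (hrow hψ hC₀ (t - b) hr a b).2
        have i2 := hdiag a b (hab.trans hbt) hbt
        rw [intervalIntegral.integral_sub (i1.sub i2) intervalIntegrable_const,
          intervalIntegral.integral_sub i1 i2, intervalIntegral.integral_const, smul_eq_mul]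
      rw [h5, ← h1, ← h3] at h4
      have h6 : t - a - (t - b) = b - a := by ring
      rw [h6] at h2
      have h4' := abs_le.1 h4
      have h2' := abs_le.1 h2
      rw [abs_le]
      constructor <;> nlinarith
  simp only [sub_self, sub_zero, intervalIntegral.integral_same] at hF
  simp only [hu, he, Real.exp_zero, mul_one, Real.toNNReal_zero] at hF
  linarith

end IsBoundedWeakSolution

/-! ### Smooth test functions determine weighted measures -/

theorem measure_Ioo_eq_of_lintegral_smooth {m m' : Measure ℝ}
    (h : ∀ ψ : ℝ → ℝ, IsSmoothTestFunction ψ → (∀ x, 0 ≤ ψ x) →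
      ∫⁻ x, ENNReal.ofReal (ψ x) ∂m = ∫⁻ x, ENNReal.ofReal (ψ x) ∂m') {a b : ℝ} (ha : 0 < a) :
    m (Ioo a b) = m' (Ioo a b) := by
  obtain ⟨f, hsupp, hsmooth, hrange⟩ :=
    IsOpen.exists_contDiff_support_eq (n := ⊤) (isOpen_Ioo (a := a) (b := b))
  have hf (x : ℝ) : 0 ≤ f x ∧ f x ≤ 1 := hrange (mem_range_self x)
  set ψ : ℕ → ℝ → ℝ := fun n x => 1 - (1 - f x) ^ n with hψ
  have hsub (n : ℕ) : Function.support (ψ n) ⊆ Ioo a b := fun x hx => by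
    rw [← hsupp]
    intro h0
    exact hx (by simp [hψ, h0])
  have htsub (n : ℕ) : tsupport (ψ n) ⊆ Icc a b :=
    closure_minimal ((hsub n).trans Ioo_subset_Icc_self) isClosed_Icc
  have htest (n : ℕ) : IsSmoothTestFunction (ψ n) :=
    ⟨contDiff_const.sub ((contDiff_const.sub hsmooth).pow n),
      isCompact_Icc.of_isClosed_subset (isClosed_tsupport _) (htsub n),
      fun x hx => ha.trans_le (htsub n hx).1⟩
  have hnonneg (n : ℕ) (x : ℝ) : 0 ≤ ψ n x :=
    sub_nonneg.2 (pow_le_one₀ (by linarith [(hf x).2]) (by linarith [(hf x).1]))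
  have hmono (x : ℝ) : Monotone fun n => ENNReal.ofReal (ψ n x) := fun p q hpq =>
    ENNReal.ofReal_le_ofReal (sub_le_sub_left
      (pow_le_pow_of_le_one (by linarith [(hf x).2]) (by linarith [(hf x).1]) hpq) 1)
  have hlim (x : ℝ) : Tendsto (fun n => ENNReal.ofReal (ψ n x)) atTop
      (nhds ((Ioo a b).indicator (fun _ => 1) x)) := by
    by_cases hx : x ∈ Ioo a b
    · rw [indicator_of_mem hx]
      have h0 : f x ≠ 0 := by
        rw [← hsupp] at hx
        exact hx
      have h1 : 0 < f x := lt_of_le_of_ne (hf x).1 h0.symm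
      have h2 := tendsto_pow_atTop_nhds_zero_of_lt_one (r := 1 - f x) (by linarith [(hf x).2])
        (by linarith)
      have h3 := ENNReal.tendsto_ofReal (h2.const_sub 1)
      simpa using h3
    · rw [indicator_of_notMem hx]
      have h0 : ∀ n, ψ n x = 0 := fun n => Function.notMem_support.1 fun h => hx (hsub n h)
      simp [h0]
  have hconv (ρ : Measure ℝ) : Tendsto (fun n => ∫⁻ x, ENNReal.ofReal (ψ n x) ∂ρ) atTop
      (nhds (ρ (Ioo a b))) := by
    have h1 := lintegral_tendsto_of_tendsto_of_monotone (μ := ρ)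
      (fun n => ((htest n).contDiff.continuous.measurable.ennreal_ofReal).aemeasurable)
      (Eventually.of_forall hmono) (Eventually.of_forall hlim)
    rwa [lintegral_indicator_const measurableSet_Ioo, one_mul] at h1
  refine tendsto_nhds_unique (hconv m) ((hconv m').congr fun n => ?_)
  exact (h (ψ n) (htest n) (hnonneg n)).symm

theorem restrict_Ioi_eq_of_lintegral_weight {R : ℝ → ℝ≥0}
    (hRloc : LocallyIntegrableOn (fun x => (R x : ℝ)) (Ioi 0)) {m m' : Measure ℝ}
    [IsFiniteMeasure m]
    (h : ∀ ψ : ℝ → ℝ, IsSmoothTestFunction ψ → (∀ x, 0 ≤ ψ x) →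
      ∫⁻ x, ENNReal.ofReal (weight R x * ψ x) ∂m =
        ∫⁻ x, ENNReal.ofReal (weight R x * ψ x) ∂m') :
    m.restrict (Ioi 0) = m'.restrict (Ioi 0) := by
  set W : ℝ → ℝ≥0∞ := fun x => ENNReal.ofReal (weight R x) with hW
  have hWm : Measurable W := (measurable_weight hRloc).ennreal_ofReal
  have hIoo {a b : ℝ} (ha : 0 < a) :
      m.withDensity W (Ioo a b) = m'.withDensity W (Ioo a b) := by
    refine measure_Ioo_eq_of_lintegral_smooth (fun ψ hψ h0 => ?_) ha
    have hm : Measurable fun x => ENNReal.ofReal (ψ x) :=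
      hψ.contDiff.continuous.measurable.ennreal_ofReal
    rw [lintegral_withDensity_eq_lintegral_mul _ hWm hm,
      lintegral_withDensity_eq_lintegral_mul _ hWm hm]
    simpa only [hW, Pi.mul_apply, ENNReal.ofReal_mul (weight_nonneg _)] using h ψ hψ h0
  have hfin : IsLocallyFiniteMeasure (m.withDensity W) := by
    refine ⟨fun x => ⟨Iio (x + 1), Iio_mem_nhds (by linarith), ?_⟩⟩
    rw [withDensity_apply _ measurableSet_Iio]
    calc ∫⁻ y in Iio (x + 1), W y ∂m ≤ ∫⁻ _ in Iio (x + 1), W (x + 1) ∂m :=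
          setLIntegral_mono' measurableSet_Iio fun y hy =>
            ENNReal.ofReal_le_ofReal (weight_mono hRloc (le_of_lt hy))
      _ < ∞ := by
          rw [lintegral_const]
          exact ENNReal.mul_lt_top ENNReal.ofReal_lt_top (measure_lt_top _ _)
  have hres (c : ℝ) (hc : 0 < c) :
      (m.withDensity W).restrict (Ioi c) = (m'.withDensity W).restrict (Ioi c) := by
    refine Real.measure_ext_Ioo_rat fun a b => ?_
    rw [Measure.restrict_apply measurableSet_Ioo, Measure.restrict_apply measurableSet_Ioo,
      show Ioo (a : ℝ) b ∩ Ioi c = Ioo (max (a : ℝ) c) b by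
        ext y
        simp only [mem_inter_iff, mem_Ioo, mem_Ioi, max_lt_iff]
        tauto]
    exact hIoo (lt_max_of_lt_right hc)
  have hU : Ioi (0 : ℝ) = ⋃ n : ℕ, Ioi (1 / ((n : ℝ) + 1)) := by
    ext y
    simp only [mem_Ioi, mem_iUnion]
    exact ⟨fun hy => exists_nat_one_div_lt hy, fun ⟨n, hn⟩ => lt_trans (by positivity) hn⟩
  have hres0 : (m.withDensity W).restrict (Ioi 0) = (m'.withDensity W).restrict (Ioi 0) := by
    rw [hU, Measure.restrict_iUnion_congr]
    exact fun n => hres _ (by positivity)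
  have hinv (ρ : Measure ℝ) : ((ρ.withDensity W).restrict (Ioi 0)).withDensity W⁻¹ =
      ρ.restrict (Ioi 0) := by
    rw [restrict_withDensity measurableSet_Ioi]
    refine withDensity_inv_same hWm ?_ (Eventually.of_forall fun x => ENNReal.ofReal_ne_top)
    filter_upwards [ae_restrict_mem measurableSet_Ioi] with x hx
    simp only [hW, weight_of_pos (mem_Ioi.1 hx)]
    exact (ENNReal.ofReal_pos.2 (Real.exp_pos _)).ne'
  rw [← hinv m, ← hinv m', hres0]

/-! ### The flux of jumps and the renewal equation -/

theorem measurable_survivor_uncurry {R : ℝ → ℝ≥0} (hR : Measurable R) :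
    Measurable fun p : ℝ × ℝ => survivor R p.1 p.2.toNNReal := by
  have h : Measurable fun p : ℝ × ℝ =>
      ∫⁻ u in Ioc p.1 (p.1 * Real.exp p.2.toNNReal), (R u : ℝ≥0∞) := by
    have h1 : (fun p : ℝ × ℝ => ∫⁻ u in Ioc p.1 (p.1 * Real.exp p.2.toNNReal), (R u : ℝ≥0∞)) =
        fun p : ℝ × ℝ => ∫⁻ u, ({q : (ℝ × ℝ) × ℝ | q.1.1 < q.2 ∧
          q.2 ≤ q.1.1 * Real.exp q.1.2.toNNReal}).indicator
          (fun q => (R q.2 : ℝ≥0∞)) (p, u) := by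
      funext p
      rw [← lintegral_indicator measurableSet_Ioc]
      rfl
    rw [h1]
    refine Measurable.lintegral_prod_right' (Measurable.indicator (by fun_prop) ?_)
    exact (measurableSet_lt (by fun_prop) measurable_snd).inter
      (measurableSet_le measurable_snd (by fun_prop))
  exact EReal.exp_monotone.measurable.comp h.coe_ereal_ennreal.neg

theorem ae_uniform_pos : ∀ᵐ v ∂uniform, 0 < v := by
  rw [uniform]
  filter_upwards [ae_restrict_mem measurableSet_Ioo] with v hv using hv.1

theorem survivor_mul_weight {R : ℝ → ℝ≥0}
    (hRloc : LocallyIntegrableOn (fun x => (R x : ℝ)) (Ioi 0)) {x : ℝ} (hx : 0 < x) {r : ℝ}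
    (hr : 0 ≤ r) (c : ℝ) :
    survivor R x r.toNNReal * ENNReal.ofReal (weight R (x * Real.exp r) * c) =
      ENNReal.ofReal (weight R x * c) := by
  rw [survivor_eq hRloc hx, Real.coe_toNNReal r hr, ← ENNReal.ofReal_mul (Real.exp_pos _).le,
    ← mul_assoc, weight_of_pos (by positivity), weight_of_pos hx, ← Real.exp_add, sub_add_cancel]

namespace IsBoundedWeakSolution

variable {R : ℝ → ℝ≥0} {M : ℝ≥0} {μ : ℝ≥0 → Measure ℝ}

/-- The law of times and positions of jumps prescribed by a weak solution: `c(x) μ_s(dx) ds`,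
pushed forward by a jump. -/
noncomputable def flux (h : IsBoundedWeakSolution R M μ) : Measure (ℝ × ℝ) :=
  ((((volume.restrict (Ioi 0)) ⊗ₘ h.kernel).prod uniform).withDensity
    fun q => ENNReal.ofReal q.1.2 * R q.1.2).map fun q => (q.1.1, q.1.2 * √q.2)

theorem lintegral_flux (h : IsBoundedWeakSolution R M μ) (hR : Measurable R)
    {Φ : ℝ × ℝ → ℝ≥0∞} (hΦ : Measurable Φ) :
    ∫⁻ p, Φ p ∂h.flux = ∫⁻ s in Ioi 0, ∫⁻ x, ENNReal.ofReal x * R x *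
      ∫⁻ v, Φ (s, x * √v) ∂uniform ∂(μ s.toNNReal) := by
  have hm : Measurable fun q : (ℝ × ℝ) × ℝ => (q.1.1, q.1.2 * √q.2) := by fun_prop
  have hΦm : Measurable fun q : (ℝ × ℝ) × ℝ => Φ (q.1.1, q.1.2 * √q.2) := hΦ.comp hm
  have hd : Measurable fun q : (ℝ × ℝ) × ℝ => ENNReal.ofReal q.1.2 * (R q.1.2 : ℝ≥0∞) := by
    fun_prop
  rw [flux, lintegral_map hΦ hm, lintegral_withDensity_eq_lintegral_mul _ hd hΦm,
    lintegral_prod _ (hd.mul hΦm).aemeasurable,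
    Measure.lintegral_compProd (hd.mul hΦm).lintegral_prod_right']
  refine lintegral_congr fun s => lintegral_congr fun x => ?_
  exact lintegral_const_mul (ENNReal.ofReal x * R x) (show Measurable fun v => Φ (s, x * √v) from
    hΦ.comp (by fun_prop))

instance (h : IsBoundedWeakSolution R M μ) : SFinite h.flux := by
  unfold flux
  infer_instance

theorem ae_flux_time_pos (h : IsBoundedWeakSolution R M μ) (hR : Measurable R) :
    ∀ᵐ p ∂h.flux, 0 < p.1 := by
  have hs : MeasurableSet {p : ℝ × ℝ | ¬ 0 < p.1} :=
    (measurableSet_lt measurable_const measurable_fst).compl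
  rw [ae_iff, ← lintegral_indicator_one hs,
    h.lintegral_flux hR (measurable_one.indicator hs)]
  refine (setLIntegral_congr_fun measurableSet_Ioi fun s hs => ?_).trans lintegral_zero
  have h0 (y : ℝ) : ({p : ℝ × ℝ | ¬ 0 < p.1}).indicator (1 : ℝ × ℝ → ℝ≥0∞) (s, y) = 0 :=
    indicator_of_notMem (by simpa using hs) _
  simp only [h0, lintegral_zero, mul_zero]

theorem ae_flux_pos (h : IsBoundedWeakSolution R M μ) (hR : Measurable R) :
    ∀ᵐ p ∂h.flux, 0 < p.2 := by
  have hs : MeasurableSet {p : ℝ × ℝ | ¬ 0 < p.2} :=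
    (measurableSet_lt measurable_const measurable_snd).compl
  rw [ae_iff, ← lintegral_indicator_one hs,
    h.lintegral_flux hR (measurable_one.indicator hs)]
  refine (lintegral_congr fun s => ?_).trans lintegral_zero
  refine (lintegral_congr_ae ?_).trans lintegral_zero
  filter_upwards [h.ae_pos s.toNNReal] with x hx
  have h0 : ∫⁻ v, ({p : ℝ × ℝ | ¬ 0 < p.2}).indicator (1 : ℝ × ℝ → ℝ≥0∞) (s, x * √v)
      ∂uniform = 0 := by
    refine (lintegral_congr_ae ?_).trans lintegral_zero
    filter_upwards [ae_uniform_pos] with v hv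
    have : 0 < x * √v := by positivity
    exact indicator_of_notMem (by simpa using this) _
  rw [h0, mul_zero]

/-- The measure at time `t` generated by transporting the initial measure and the jumps before
time `t`. -/
noncomputable def renewal (h : IsBoundedWeakSolution R M μ) (t : ℝ) : Measure ℝ :=
  ((μ 0).withDensity fun x => survivor R x t.toNNReal).map (fun x => x * Real.exp t) +
    (h.flux.withDensity ({p | p.1 ≤ t}.indicator fun p => survivor R p.2 (t - p.1).toNNReal)).map
      fun p => p.2 * Real.exp (t - p.1)

theorem measurable_survivor_indicator (hR : Measurable R) (t : ℝ) :
    Measurable ({p : ℝ × ℝ | p.1 ≤ t}.indicator fun p => survivor R p.2 (t - p.1).toNNReal) :=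
  ((measurable_survivor_uncurry hR).comp (by fun_prop :
    Measurable fun p : ℝ × ℝ => (p.2, t - p.1))).indicator
    (measurableSet_le measurable_fst measurable_const)

theorem lintegral_renewal (h : IsBoundedWeakSolution R M μ) (hR : Measurable R) (t : ℝ)
    {g : ℝ → ℝ≥0∞} (hg : Measurable g) :
    ∫⁻ x, g x ∂(h.renewal t) =
      ∫⁻ x, survivor R x t.toNNReal * g (x * Real.exp t) ∂(μ 0) +
      ∫⁻ p, ({p | p.1 ≤ t}.indicator fun p => survivor R p.2 (t - p.1).toNNReal) p *
        g (p.2 * Real.exp (t - p.1)) ∂h.flux := by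
  have h1 : Measurable fun x : ℝ => x * Real.exp t := by fun_prop
  have h2 : Measurable fun p : ℝ × ℝ => p.2 * Real.exp (t - p.1) := by fun_prop
  rw [renewal, lintegral_add_measure, lintegral_map hg h1, lintegral_map hg h2,
    lintegral_withDensity_eq_lintegral_mul _ (measurable_survivor hR _)
      (show Measurable fun x => g (x * Real.exp t) from hg.comp h1),
    lintegral_withDensity_eq_lintegral_mul _ (measurable_survivor_indicator hR t)
      (show Measurable fun p : ℝ × ℝ => g (p.2 * Real.exp (t - p.1)) from hg.comp h2)]
  rfl

theorem lintegral_weight_renewal (h : IsBoundedWeakSolution R M μ) (hR : Measurable R)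
    (hRloc : LocallyIntegrableOn (fun x => (R x : ℝ)) (Ioi 0)) {t : ℝ} (ht : 0 ≤ t)
    {ψ : ℝ → ℝ} (hψ : IsSmoothTestFunction ψ) (h0 : ∀ x, 0 ≤ ψ x) :
    ∫⁻ x, ENNReal.ofReal (weight R x * ψ x) ∂(μ t.toNNReal) =
      ∫⁻ x, ENNReal.ofReal (weight R x * ψ x) ∂(h.renewal t) := by
  obtain ⟨C, hC⟩ := hψ.exists_weight_bound hRloc
  have hsec (r : ℝ) : Measurable fun x => weight R x * ψ (x * Real.exp r) :=
    (measurable_weight_mul_dilate hRloc hψ (measurable_const (a := r))).comp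
      (measurable_const.prodMk measurable_id : Measurable fun x : ℝ => (((0 : ℝ), x)))
  have hwm : Measurable fun x => weight R x * ψ x := by simpa using hsec 0
  have hnn (r x : ℝ) : 0 ≤ weight R x * ψ (x * Real.exp r) :=
    mul_nonneg (weight_nonneg x) (h0 _)
  have hKm (r : ℝ) : Measurable (jumpAverage fun y => weight R y * ψ (y * Real.exp r)) :=
    (measurable_jumpAverage (α := Unit) (f := fun _ y => weight R y * ψ (y * Real.exp r))
      ((hsec r).comp measurable_snd)).comp
      (measurable_const.prodMk measurable_id : Measurable fun x : ℝ => (((), x) : Unit × ℝ))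
  have hKnn (r x : ℝ) : 0 ≤ jumpAverage (fun y => weight R y * ψ (y * Real.exp r)) x :=
    integral_nonneg fun v => hnn r _
  have hduh := h.duhamel hR hRloc hψ ht
  have hL : ∫⁻ x, ENNReal.ofReal (weight R x * ψ x) ∂(μ t.toNNReal) =
      ENNReal.ofReal (∫ x, weight R x * ψ x ∂(μ t.toNNReal)) := by
    refine (ofReal_integral_eq_lintegral_ofReal (h.integrable_of_bound _ hwm (C := C)
      fun x => by simpa using hC 0 le_rfl x) (Eventually.of_forall fun x => ?_)).symm
    simpa using hnn 0 x
  have hA : ∫⁻ x, survivor R x t.toNNReal *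
      ENNReal.ofReal (weight R (x * Real.exp t) * ψ (x * Real.exp t)) ∂(μ 0) =
      ENNReal.ofReal (∫ x, weight R x * ψ (x * Real.exp t) ∂(μ 0)) := by
    rw [ofReal_integral_eq_lintegral_ofReal (h.integrable_of_bound 0 (hsec t) (hC t ht))
      (Eventually.of_forall (hnn t))]
    refine lintegral_congr_ae ?_
    filter_upwards [h.ae_pos 0] with x hx
    exact survivor_mul_weight hRloc hx ht _
  have hinner (s : ℝ) (hs : s ≤ t) : ∫⁻ x, ENNReal.ofReal x * R x *
      ∫⁻ v, ({p : ℝ × ℝ | p.1 ≤ t}.indicator fun p => survivor R p.2 (t - p.1).toNNReal)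
        (s, x * √v) * ENNReal.ofReal (weight R (x * √v * Real.exp (t - s)) *
          ψ (x * √v * Real.exp (t - s))) ∂uniform ∂(μ s.toNNReal) =
      ENNReal.ofReal (∫ x, x * R x *
        jumpAverage (fun y => weight R y * ψ (y * Real.exp (t - s))) x ∂(μ s.toNNReal)) := by
    have hr : 0 ≤ t - s := sub_nonneg.2 hs
    rw [ofReal_integral_eq_lintegral_ofReal (h.integrable_rate_mul hR _ (hKm (t - s))
      (abs_jumpAverage_le (hC (t - s) hr)))]
    · refine lintegral_congr_ae ?_
      filter_upwards [h.ae_pos s.toNNReal] with x hx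
      rw [ENNReal.ofReal_mul (by positivity), ENNReal.ofReal_mul hx.le,
        ENNReal.ofReal_coe_nnreal, jumpAverage, ofReal_integral_eq_lintegral_ofReal]
      · congr 1
        refine lintegral_congr_ae ?_
        filter_upwards [ae_uniform_pos] with v hv
        rw [indicator_of_mem (show (s, x * √v) ∈ {p : ℝ × ℝ | p.1 ≤ t} from hs)]
        exact survivor_mul_weight hRloc (by positivity) hr _
      · exact Integrable.of_bound ((hsec (t - s)).comp
          (by fun_prop : Measurable fun v => x * √v)).aestronglyMeasurable C
          (Eventually.of_forall fun v => hC (t - s) hr _)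
      · exact Eventually.of_forall fun v => hnn _ _
    · filter_upwards [h.ae_pos s.toNNReal] with x hx
      exact mul_nonneg (by positivity) (hKnn _ _)
  have hB : ∫⁻ p, ({p | p.1 ≤ t}.indicator fun p => survivor R p.2 (t - p.1).toNNReal) p *
        ENNReal.ofReal (weight R (p.2 * Real.exp (t - p.1)) * ψ (p.2 * Real.exp (t - p.1)))
          ∂h.flux =
      ENNReal.ofReal (∫ s in (0 : ℝ)..t, ∫ x, x * R x *
        jumpAverage (fun y => weight R y * ψ (y * Real.exp (t - s))) x ∂(μ s.toNNReal)) := by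
    have hm : Measurable fun p : ℝ × ℝ =>
        ENNReal.ofReal (weight R (p.2 * Real.exp (t - p.1)) * ψ (p.2 * Real.exp (t - p.1))) :=
      (hwm.comp (by fun_prop : Measurable fun p : ℝ × ℝ => p.2 * Real.exp (t - p.1))).ennreal_ofReal
    have hii : IntervalIntegrable (fun s : ℝ => ∫ x, x * R x *
        jumpAverage (fun y => weight R y * ψ (y * Real.exp (t - s))) x ∂(μ s.toNNReal))
        volume 0 t := by
      refine h.intervalIntegrable_integral (measurable_rate_mul_jumpAverage hR hRloc hψ
        (measurable_const.sub measurable_id : Measurable fun q : ℝ => t - q)) (C := M * C)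
        fun s hs => ?_
      rw [uIoc_of_le ht] at hs
      exact h.abs_integral_rate_mul_le hR _
        (abs_jumpAverage_le (hC (t - s) (sub_nonneg.2 hs.2)))
    refine (h.lintegral_flux hR ((measurable_survivor_indicator hR t).mul hm)).trans ?_
    simp only [Pi.mul_apply]
    rw [intervalIntegral.integral_of_le ht, ofReal_integral_eq_lintegral_ofReal]
    · rw [← Ioi_inter_Iic, inter_comm, ← Measure.restrict_restrict measurableSet_Iic,
        ← lintegral_indicator measurableSet_Iic]
      refine lintegral_congr fun s => ?_
      by_cases hs : s ≤ t
      · rw [indicator_of_mem (show s ∈ Iic t from hs), ← hinner s hs]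
      · rw [indicator_of_notMem (show s ∉ Iic t from hs)]
        have h1 (y : ℝ) : ({p : ℝ × ℝ | p.1 ≤ t}.indicator
            fun p => survivor R p.2 (t - p.1).toNNReal) (s, y) = 0 :=
          indicator_of_notMem (by simpa using hs) _
        simp [h1]
    · exact (intervalIntegrable_iff_integrableOn_Ioc_of_le ht).1 hii
    · refine Eventually.of_forall fun s => ?_
      refine integral_nonneg_of_ae ?_
      filter_upwards [h.ae_pos s.toNNReal] with x hx
      exact mul_nonneg (by positivity) (hKnn _ _)
  rw [h.lintegral_renewal hR t hwm.ennreal_ofReal, hA, hB, hL, hduh, ENNReal.ofReal_add]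
  · exact integral_nonneg fun x => hnn t x
  · refine intervalIntegral.integral_nonneg ht fun s _ => integral_nonneg_of_ae ?_
    filter_upwards [h.ae_pos s.toNNReal] with x hx
    exact mul_nonneg (by positivity) (hKnn _ _)

/-- A weak solution satisfies the renewal equation. -/
theorem eq_renewal (h : IsBoundedWeakSolution R M μ) (hR : Measurable R)
    (hRloc : LocallyIntegrableOn (fun x => (R x : ℝ)) (Ioi 0)) {t : ℝ} (ht : 0 ≤ t) :
    μ t.toNNReal = h.renewal t := by
  have := h.isProbabilityMeasure t.toNNReal
  have h1 : (μ t.toNNReal).restrict (Ioi 0) = μ t.toNNReal :=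
    Measure.restrict_eq_self_of_ae_mem (h.ae_pos _)
  have h2 : (h.renewal t).restrict (Ioi 0) = h.renewal t := by
    refine Measure.restrict_eq_self_of_ae_mem ?_
    rw [renewal, ae_add_measure_iff]
    constructor
    · rw [ae_map_iff (p := fun x => x ∈ Ioi 0) (by fun_prop) measurableSet_Ioi]
      filter_upwards [(withDensity_absolutelyContinuous _ _).ae_le (h.ae_pos 0)] with x hx
      have hx : 0 < x := hx
      exact mul_pos hx (Real.exp_pos _)
    · rw [ae_map_iff (p := fun x => x ∈ Ioi 0) (by fun_prop) measurableSet_Ioi]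
      filter_upwards [(withDensity_absolutelyContinuous _ _).ae_le (h.ae_flux_pos hR)] with p hp
      have hp : 0 < p.2 := hp
      exact mul_pos hp (Real.exp_pos _)
  rw [← h1, ← h2]
  exact restrict_Ioi_eq_of_lintegral_weight hRloc fun ψ hψ h0 =>
    h.lintegral_weight_renewal hR hRloc ht hψ h0

end IsBoundedWeakSolution

/-! ### The law of the waiting time -/

theorem _root_.AbsolutelyContinuousOnInterval.of_dist_le {f g : ℝ → ℝ} {a b : ℝ}
    (hf : AbsolutelyContinuousOnInterval f a b)
    (h : ∀ x ∈ uIcc a b, ∀ y ∈ uIcc a b, dist (g x) (g y) ≤ dist (f x) (f y)) :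
    AbsolutelyContinuousOnInterval g a b := by
  rw [absolutelyContinuousOnInterval_iff] at hf ⊢
  intro ε hε
  obtain ⟨δ, hδ, hE⟩ := hf ε hε
  refine ⟨δ, hδ, fun E hEm hlen => lt_of_le_of_lt (Finset.sum_le_sum fun i hi => ?_)
    (hE E hEm hlen)⟩
  exact h _ (hEm.1 i hi).1 _ (hEm.1 i hi).2

theorem abs_exp_neg_sub_exp_neg_le {x y : ℝ} (hx : 0 ≤ x) (hy : 0 ≤ y) :
    |Real.exp (-x) - Real.exp (-y)| ≤ |x - y| := by
  wlog hxy : x ≤ y generalizing x y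
  · rw [abs_sub_comm, abs_sub_comm x]
    exact this hy hx (le_of_not_ge hxy)
  rw [abs_of_nonneg (sub_nonneg.2 (Real.exp_le_exp.2 (neg_le_neg hxy))), abs_sub_comm,
    abs_of_nonneg (sub_nonneg.2 hxy)]
  have h1 := Real.add_one_le_exp (-(y - x))
  have h2 : Real.exp (-y) = Real.exp (-x) * Real.exp (-(y - x)) := by
    rw [← Real.exp_add]
    congr 1
    ring
  have h3 : Real.exp (-x) ≤ 1 := Real.exp_le_one_iff.2 (by linarith)
  rw [h2]
  nlinarith [Real.exp_pos (-x)]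

theorem integral_mul_exp_neg_primitive {a : ℝ → ℝ} {z b : ℝ} (hzb : z ≤ b)
    (ha : IntervalIntegrable a volume z b) (h0 : ∀ x, 0 ≤ a x) :
    IntervalIntegrable (fun y => a y * Real.exp (-∫ u in z..y, a u)) volume z b ∧
      ∫ y in z..b, a y * Real.exp (-∫ u in z..y, a u) = 1 - Real.exp (-∫ u in z..b, a u) := by
  have hAC := ha.absolutelyContinuousOnInterval_intervalIntegral (c := z) left_mem_uIcc
  have hnn (y : ℝ) (hy : y ∈ uIcc z b) : 0 ≤ ∫ u in z..y, a u := by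
    rw [uIcc_of_le hzb] at hy
    exact intervalIntegral.integral_nonneg hy.1 fun u _ => h0 u
  have hf : AbsolutelyContinuousOnInterval (fun y => -Real.exp (-∫ u in z..y, a u)) z b := by
    refine hAC.of_dist_le fun x hx y hy => ?_
    rw [dist_neg_neg]
    exact abs_exp_neg_sub_exp_neg_le (hnn x hx) (hnn y hy)
  have hder : ∀ᵐ y, y ∈ uIoc z b → deriv (fun y => -Real.exp (-∫ u in z..y, a u)) y =
      a y * Real.exp (-∫ u in z..y, a u) := by
    filter_upwards [ha.ae_hasDerivAt_integral] with y hy hyb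
    have h1 := ((hy (uIoc_subset_uIcc hyb) z left_mem_uIcc).fun_neg.exp).fun_neg
    rw [h1.deriv]
    ring
  constructor
  · exact ha.mul_continuousOn (Real.continuous_exp.comp_continuousOn hAC.continuousOn.neg)
  · rw [← intervalIntegral.integral_congr_ae hder, hf.integral_deriv_eq_sub]
    simp
    ring

/-- The density `c(z e^r) S_z(r)` of the waiting time at `z`. -/
noncomputable def waitingDensity (R : ℝ → ℝ≥0) (z r : ℝ) : ℝ≥0∞ :=
  ENNReal.ofReal (z * Real.exp r) * R (z * Real.exp r) * survivor R z r.toNNReal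

theorem measurable_waitingDensity {R : ℝ → ℝ≥0} (hR : Measurable R) :
    Measurable fun p : ℝ × ℝ => waitingDensity R p.1 p.2 := by
  unfold waitingDensity
  exact Measurable.mul (by fun_prop) (measurable_survivor_uncurry hR)

section Waiting

variable {R : ℝ → ℝ≥0}

theorem lintegral_waitingDensity (hRloc : LocallyIntegrableOn (fun x => (R x : ℝ)) (Ioi 0))
    {z : ℝ} (hz : 0 < z) {t : ℝ} (ht : 0 ≤ t) :
    ∫⁻ r in Ioc 0 t, waitingDensity R z r = 1 - survivor R z t.toNNReal := by
  have hle : z ≤ z * Real.exp t := le_mul_of_one_le_right hz.le (Real.one_le_exp ht)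
  have hb : 0 < z * Real.exp t := hz.trans_le hle
  obtain ⟨hi, hint⟩ := integral_mul_exp_neg_primitive hle (intervalIntegrable_rate hRloc hz hb)
    fun x => (R x).coe_nonneg
  have h1 : ∫⁻ y in Ioc z (z * Real.exp t),
      ENNReal.ofReal (R y * Real.exp (-∫ u in z..y, (R u : ℝ))) =
      1 - survivor R z t.toNNReal := by
    rw [← ofReal_integral_eq_lintegral_ofReal
      ((intervalIntegrable_iff_integrableOn_Ioc_of_le hle).1 hi)
      (Eventually.of_forall fun y => by positivity), ← intervalIntegral.integral_of_le hle, hint,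
      ENNReal.ofReal_sub _ (Real.exp_pos _).le, ENNReal.ofReal_one, survivor_eq hRloc hz,
      Real.coe_toNNReal t ht, ← ratePrimitive_sub hRloc hz hb, neg_sub]
  have h2 := lintegral_Icc_exp_comp
    (fun y => ENNReal.ofReal (R y * Real.exp (-∫ u in z..y, (R u : ℝ)))) hb ht
  have hcancel (s : ℝ) : Real.exp (s - t) * (z * Real.exp t) = z * Real.exp s := by
    rw [mul_left_comm, ← Real.exp_add, sub_add_cancel]
  have hcancel' : Real.exp (-t) * (z * Real.exp t) = z := by
    rw [mul_left_comm, ← Real.exp_add, neg_add_cancel, Real.exp_zero, mul_one]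
  simp only [hcancel, hcancel'] at h2
  rw [← h1, restrict_Ioc_eq_restrict_Icc, restrict_Ioc_eq_restrict_Icc, ← h2]
  refine setLIntegral_congr_fun measurableSet_Icc fun r hr => ?_
  have hzr : 0 < z * Real.exp r := by positivity
  simp only [waitingDensity]
  rw [survivor_eq hRloc hz, Real.coe_toNNReal r hr.1, ENNReal.ofReal_mul (R _).coe_nonneg,
    ENNReal.ofReal_coe_nnreal, ← ratePrimitive_sub hRloc hz hzr, neg_sub, mul_assoc]

theorem survivor_le_one (z : ℝ) (t : ℝ≥0) : survivor R z t ≤ 1 := by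
  have h := survivor_antitone (R := R) (z := z) (zero_le (a := t))
  simpa [survivor] using h

theorem waitingTime_le_iff (hRloc : LocallyIntegrableOn (fun x => (R x : ℝ)) (Ioi 0))
    {z : ℝ} (hz : 0 < z) (u : ℝ) (t : ℝ≥0) :
    waitingTime R z u ≤ t ↔ survivor R z t ≤ ENNReal.ofReal u := by
  refine ⟨fun h => ?_, fun h => iInf₂_le t h⟩
  have hcont : Tendsto (fun n : ℕ => survivor R z (t + 1 / ((n : ℝ≥0) + 1))) atTop
      (nhds (survivor R z t)) := by
    simp only [survivor_eq hRloc hz]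
    have h1 : Tendsto (fun n : ℕ => z * Real.exp ((t + 1 / ((n : ℝ≥0) + 1) : ℝ≥0) : ℝ)) atTop
        (nhds (z * Real.exp t)) := by
      have h2 : Tendsto (fun n : ℕ => (t : ℝ) + 1 / ((n : ℝ) + 1)) atTop (nhds ((t : ℝ) + 0)) :=
        tendsto_one_div_add_atTop_nhds_zero_nat.const_add _
      rw [add_zero] at h2
      simpa using (h2.rexp).const_mul z
    have hpos : 0 < z * Real.exp t := by positivity
    have h3 := ((continuousOn_ratePrimitive hRloc).continuousAt (Ioi_mem_nhds hpos)).tendsto.comp h1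
    exact ENNReal.tendsto_ofReal ((h3.const_sub (ratePrimitive R z)).rexp)
  refine le_of_tendsto' hcont fun n => ?_
  have hlt : waitingTime R z u < (t + 1 / ((n : ℝ≥0) + 1) : ℝ≥0) :=
    lt_of_le_of_lt h (ENNReal.coe_lt_coe.2 (lt_add_of_pos_right t (by positivity)))
  simp only [waitingTime, iInf_lt_iff] at hlt
  obtain ⟨s, hs, hst⟩ := hlt
  exact (survivor_antitone (ENNReal.coe_lt_coe.1 hst).le).trans hs

theorem uniform_lt_waitingTime (hRloc : LocallyIntegrableOn (fun x => (R x : ℝ)) (Ioi 0))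
    {z : ℝ} (hz : 0 < z) (t : ℝ≥0) :
    uniform {u | (t : ℝ≥0∞) < waitingTime R z u} = survivor R z t := by
  have hset : {u | (t : ℝ≥0∞) < waitingTime R z u} =
      {u | ENNReal.ofReal u < survivor R z t} := by
    ext u
    rw [mem_ofPred_eq, mem_ofPred_eq, ← not_le, waitingTime_le_iff hRloc hz, not_le]
  set σ := Real.exp (ratePrimitive R z - ratePrimitive R (z * Real.exp t)) with hσ
  have hS : survivor R z t = ENNReal.ofReal σ := survivor_eq hRloc hz t
  have hσ0 : 0 < σ := Real.exp_pos _
  have hσ1 : σ ≤ 1 := by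
    have := survivor_le_one (R := R) z t
    rw [hS] at this
    exact ENNReal.ofReal_le_one.1 this
  have hset' : {u | ENNReal.ofReal u < survivor R z t} = Iio σ := by
    ext u
    rw [mem_ofPred_eq, hS, mem_Iio, ENNReal.ofReal_lt_ofReal_iff hσ0]
  rw [hset, hset', hS, uniform, Measure.restrict_apply measurableSet_Iio, inter_comm,
    Ioo_inter_Iio, min_eq_right hσ1, Real.volume_Ioo, sub_zero]

theorem lintegral_waitingTime (hR : Measurable R)
    (hRloc : LocallyIntegrableOn (fun x => (R x : ℝ)) (Ioi 0))
    {z : ℝ} (hz : 0 < z) {g : ℝ → ℝ≥0∞} (hg : Measurable g) :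
    ∫⁻ u, ({u | waitingTime R z u ≠ ∞}.indicator fun u => g (waitingTime R z u).toReal) u
        ∂uniform = ∫⁻ r in Ioi 0, waitingDensity R z r * g r := by
  have hWm : Measurable fun u => waitingTime R z u :=
    Measurable.comp (g := fun p : ℝ × ℝ => waitingTime R p.1 p.2) (f := fun u => (z, u))
      (measurable_waitingTime hR) measurable_prodMk_left
  have hfin : MeasurableSet {u | waitingTime R z u ≠ ∞} :=
    (hWm (measurableSet_singleton ∞)).compl
  have hdm : Measurable fun r => waitingDensity R z r :=
    (measurable_waitingDensity hR).comp measurable_prodMk_left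
  have hlaw : (uniform.restrict {u | waitingTime R z u ≠ ∞}).map
      (fun u => (waitingTime R z u).toReal) =
      (volume.restrict (Ioi 0)).withDensity (waitingDensity R z) := by
    refine Measure.ext_of_Iic _ _ fun t => ?_
    rw [Measure.map_apply hWm.ennreal_toReal measurableSet_Iic,
      Measure.restrict_apply (hWm.ennreal_toReal measurableSet_Iic),
      withDensity_apply _ measurableSet_Iic, Measure.restrict_restrict measurableSet_Iic,
      inter_comm (Iic t), Ioi_inter_Iic]
    rcases lt_or_ge t 0 with ht | ht
    · have h1 : (fun u => (waitingTime R z u).toReal) ⁻¹' Iic t = ∅ := by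
        ext u
        simpa using ht.trans_le ENNReal.toReal_nonneg
      rw [h1, empty_inter, measure_empty, Ioc_eq_empty (not_lt.2 ht.le)]
      simp
    · have h1 : (fun u => (waitingTime R z u).toReal) ⁻¹' Iic t ∩ {u | waitingTime R z u ≠ ∞} =
          {u | ((t.toNNReal : ℝ≥0) : ℝ≥0∞) < waitingTime R z u}ᶜ := by
        ext u
        simp only [mem_inter_iff, mem_preimage, mem_Iic, mem_ofPred_eq, mem_compl_iff, not_lt]
        constructor
        · rintro ⟨h2, h3⟩
          exact (ENNReal.le_ofReal_iff_toReal_le h3 ht).2 h2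
        · intro h2
          have h3 := ne_top_of_le_ne_top ENNReal.coe_ne_top h2
          exact ⟨(ENNReal.le_ofReal_iff_toReal_le h3 ht).1 h2, h3⟩
      rw [h1, measure_compl (measurableSet_lt measurable_const hWm) (measure_ne_top _ _),
        measure_univ, uniform_lt_waitingTime hRloc hz, lintegral_waitingDensity hRloc hz ht]
  calc _ = ∫⁻ u in {u | waitingTime R z u ≠ ∞}, g (waitingTime R z u).toReal ∂uniform :=
        lintegral_indicator hfin _
    _ = ∫⁻ r, g r ∂(uniform.restrict {u | waitingTime R z u ≠ ∞}).map
          (fun u => (waitingTime R z u).toReal) := (lintegral_map hg hWm.ennreal_toReal).symm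
    _ = ∫⁻ r in Ioi 0, waitingDensity R z r * g r := by
        rw [hlaw, lintegral_withDensity_eq_lintegral_mul _ hdm hg]
        rfl

end Waiting

/-! ### Resampling one coordinate of the noise -/

theorem measurePreserving_update (k : ℕ) :
    MeasurePreserving (fun p : (ℕ → ℝ) × ℝ => Function.update p.1 k p.2)
      (noise.prod uniform) noise := by
  have hm : Measurable fun p : (ℕ → ℝ) × ℝ => Function.update p.1 k p.2 := by
    refine measurable_pi_lambda _ fun i => ?_
    by_cases hi : i = k
    · subst hi
      simpa using measurable_snd
    · simp only [Function.update_of_ne hi]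
      fun_prop
  refine ⟨hm, ?_⟩
  refine Measure.eq_infinitePi _ fun s t ht => ?_
  have hpre : (fun p : (ℕ → ℝ) × ℝ => Function.update p.1 k p.2) ⁻¹' (s : Set ℕ).pi t =
      ((s.erase k : Finset ℕ) : Set ℕ).pi t ×ˢ (if k ∈ s then t k else univ) := by
    ext p
    simp only [mem_preimage, Set.mem_pi, Finset.mem_coe, mem_prod, Finset.mem_erase]
    constructor
    · intro h
      refine ⟨fun i hi => by simpa [Function.update_of_ne hi.1] using h i hi.2, ?_⟩
      split_ifs with hk
      · simpa using h k hk
      · trivial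
    · rintro ⟨h1, h2⟩ i hi
      by_cases hik : i = k
      · subst hik
        simpa [hi] using h2
      · simpa [Function.update_of_ne hik] using h1 i ⟨hik, hi⟩
  rw [Measure.map_apply hm (MeasurableSet.pi s.countable_toSet fun i _ => ht i), hpre,
    Measure.prod_prod, noise, Measure.infinitePi_pi _ fun i _ => ht i]
  split_ifs with hk
  · rw [Finset.prod_erase_mul s (fun i => uniform (t i)) hk]
  · rw [measure_univ, mul_one, Finset.erase_eq_of_notMem hk]

theorem lintegral_noise_update (k : ℕ) {H : (ℕ → ℝ) → ℝ≥0∞} (hH : Measurable H) :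
    ∫⁻ ω, H ω ∂noise = ∫⁻ ω, ∫⁻ u, H (Function.update ω k u) ∂uniform ∂noise := by
  have hmp := measurePreserving_update k
  rw [← hmp.lintegral_comp hH]
  exact lintegral_prod _ (hH.comp hmp.measurable).aemeasurable

/-! ### One step of the cell process -/

section Step

variable {R : ℝ → ℝ≥0}

/-- The position `x e^{τ_k} J_1 ⋯ J_k` after the `k`-th jump. -/
noncomputable def jumpPosition (R : ℝ → ℝ≥0) (x : ℝ) (ω : ℕ → ℝ) (k : ℕ) : ℝ :=
  x * Real.exp (jumpTime R x ω k).toReal * jumpProd ω k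

theorem jumpTime_succ (x : ℝ) (ω : ℕ → ℝ) (k : ℕ) :
    jumpTime R x ω (k + 1) =
      jumpTime R x ω k + waitingTime R (jumpPosition R x ω k) (ω (2 * k)) := rfl

theorem jumpProd_succ (ω : ℕ → ℝ) (k : ℕ) :
    jumpProd ω (k + 1) = jumpProd ω k * √(ω (2 * k + 1)) :=
  Finset.prod_range_succ _ _

theorem jumpProd_update {k i : ℕ} (hi : 2 * k ≤ i) (ω : ℕ → ℝ) (u : ℝ) :
    jumpProd (Function.update ω i u) k = jumpProd ω k := by
  refine Finset.prod_congr rfl fun j hj => ?_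
  have := Finset.mem_range.1 hj
  rw [Function.update_of_ne (by omega)]

theorem jumpTime_update (x : ℝ) {k i : ℕ} (hi : 2 * k ≤ i) (ω : ℕ → ℝ) (u : ℝ) :
    jumpTime R x (Function.update ω i u) k = jumpTime R x ω k := by
  induction k with
  | zero => rfl
  | succ k ih =>
    rw [jumpTime_succ, jumpTime_succ, jumpPosition, jumpPosition, ih (by omega),
      jumpProd_update (by omega), Function.update_of_ne (by omega)]

theorem jumpPosition_update (x : ℝ) {k i : ℕ} (hi : 2 * k ≤ i) (ω : ℕ → ℝ) (u : ℝ) :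
    jumpPosition R x (Function.update ω i u) k = jumpPosition R x ω k := by
  rw [jumpPosition, jumpPosition, jumpTime_update x hi, jumpProd_update hi]

theorem ae_jumpProd_pos (k : ℕ) : ∀ᵐ ω ∂noise, 0 < jumpProd ω k := by
  have h (i : ℕ) : ∀ᵐ ω ∂noise, 0 < ω i :=
    (measurePreserving_eval_infinitePi (fun _ : ℕ => uniform) i).quasiMeasurePreserving.ae
      ae_uniform_pos
  filter_upwards [ae_all_iff.2 h] with ω hω
  exact Finset.prod_pos fun j _ => Real.sqrt_pos.2 (hω _)

theorem measurable_jumpPosition (hR : Measurable R) (k : ℕ) :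
    Measurable fun p : ℝ × (ℕ → ℝ) => jumpPosition R p.1 p.2 k := by
  have h1 := (measurable_jumpTime hR k).ennreal_toReal
  have h2 : Measurable fun p : ℝ × (ℕ → ℝ) => jumpProd p.2 k :=
    (measurable_jumpProd k).comp measurable_snd
  exact (measurable_fst.mul h1.exp).mul h2

open Classical in
/-- The value of `Φ` at the time and position of the `k`-th jump, if there is one. -/
noncomputable def atJump (R : ℝ → ℝ≥0) (Φ : ℝ × ℝ → ℝ≥0∞) (k : ℕ) (x : ℝ) (ω : ℕ → ℝ) : ℝ≥0∞ :=
  if jumpTime R x ω k = ∞ then 0 else Φ ((jumpTime R x ω k).toReal, jumpPosition R x ω k)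

theorem measurable_atJump (hR : Measurable R) {Φ : ℝ × ℝ → ℝ≥0∞} (hΦ : Measurable Φ) (k : ℕ) :
    Measurable fun p : ℝ × (ℕ → ℝ) => atJump R Φ k p.1 p.2 := by
  have h1 := measurable_jumpTime hR k
  exact Measurable.ite (h1 (measurableSet_singleton ∞)) measurable_const
    (hΦ.comp (h1.ennreal_toReal.prodMk (measurable_jumpPosition hR k)))

/-- The transition operator of the chain of jump times and positions. -/
noncomputable def jumpStep (R : ℝ → ℝ≥0) (Φ : ℝ × ℝ → ℝ≥0∞) (p : ℝ × ℝ) : ℝ≥0∞ :=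
  ∫⁻ r in Ioi 0, waitingDensity R p.2 r *
    ∫⁻ v, Φ (p.1 + r, p.2 * Real.exp r * √v) ∂uniform

theorem measurable_jumpStep (hR : Measurable R) {Φ : ℝ × ℝ → ℝ≥0∞} (hΦ : Measurable Φ) :
    Measurable (jumpStep R Φ) := by
  have h1 : Measurable fun q : (ℝ × ℝ) × ℝ => waitingDensity R q.1.2 q.2 :=
    (measurable_waitingDensity hR).comp
      (by fun_prop : Measurable fun q : (ℝ × ℝ) × ℝ => (q.1.2, q.2))
  have h2 : Measurable fun q : ((ℝ × ℝ) × ℝ) × ℝ =>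
      Φ (q.1.1.1 + q.1.2, q.1.1.2 * Real.exp q.1.2 * √q.2) := hΦ.comp (by fun_prop)
  exact (h1.mul h2.lintegral_prod_right').lintegral_prod_right'

theorem lintegral_atJump_succ (hR : Measurable R)
    (hRloc : LocallyIntegrableOn (fun x => (R x : ℝ)) (Ioi 0)) {x : ℝ} (hx : 0 < x)
    {Φ : ℝ × ℝ → ℝ≥0∞} (hΦ : Measurable Φ) (k : ℕ) :
    ∫⁻ ω, atJump R Φ (k + 1) x ω ∂noise = ∫⁻ ω, atJump R (jumpStep R Φ) k x ω ∂noise := by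
  have hm1 : Measurable fun ω => atJump R Φ (k + 1) x ω :=
    Measurable.comp (g := fun p : ℝ × (ℕ → ℝ) => atJump R Φ (k + 1) p.1 p.2)
      (f := fun ω => (x, ω)) (measurable_atJump hR hΦ (k + 1)) measurable_prodMk_left
  have hm2 : Measurable fun ω => ∫⁻ v, atJump R Φ (k + 1) x (Function.update ω (2 * k + 1) v)
      ∂uniform :=
    (hm1.comp (measurePreserving_update (2 * k + 1)).measurable).lintegral_prod_right'
  rw [lintegral_noise_update (2 * k + 1) hm1, lintegral_noise_update (2 * k) hm2]
  refine lintegral_congr_ae ?_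
  filter_upwards [ae_jumpProd_pos k] with ω hω
  have hpos : 0 < jumpPosition R x ω k := by
    unfold jumpPosition
    positivity
  have htime (u v : ℝ) :
      jumpTime R x (Function.update (Function.update ω (2 * k) u) (2 * k + 1) v) (k + 1) =
      jumpTime R x ω k + waitingTime R (jumpPosition R x ω k) u := by
    rw [jumpTime_succ, jumpTime_update x (by omega), jumpTime_update x le_rfl,
      jumpPosition_update x (by omega), jumpPosition_update x le_rfl,
      Function.update_of_ne (by omega), Function.update_self]
  have hprod (u v : ℝ) :
      jumpProd (Function.update (Function.update ω (2 * k) u) (2 * k + 1) v) (k + 1) =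
      jumpProd ω k * √v := by
    rw [jumpProd_succ, jumpProd_update (by omega), jumpProd_update le_rfl, Function.update_self]
  by_cases hτ : jumpTime R x ω k = ∞
  · simp only [atJump, htime, hτ, top_add, if_true, lintegral_zero]
  · have hstep : atJump R (jumpStep R Φ) k x ω =
        jumpStep R Φ ((jumpTime R x ω k).toReal, jumpPosition R x ω k) := if_neg hτ
    have hgm : Measurable fun r => ∫⁻ v, Φ ((jumpTime R x ω k).toReal + r,
        jumpPosition R x ω k * Real.exp r * √v) ∂uniform := by
      have h2 : Measurable fun q : ℝ × ℝ => Φ ((jumpTime R x ω k).toReal + q.1,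
        jumpPosition R x ω k * Real.exp q.1 * √q.2) := hΦ.comp (by fun_prop)
      exact h2.lintegral_prod_right'
    rw [hstep, jumpStep, ← lintegral_waitingTime hR hRloc hpos hgm]
    refine lintegral_congr fun u => ?_
    by_cases hW : waitingTime R (jumpPosition R x ω k) u = ∞
    · rw [indicator_of_notMem (by simpa using hW)]
      simp only [atJump, htime, hW, add_top, if_true, lintegral_zero]
    · rw [indicator_of_mem (show u ∈ {u | waitingTime R (jumpPosition R x ω k) u ≠ ∞} from hW)]
      refine lintegral_congr fun v => ?_
      rw [atJump, jumpPosition, htime, hprod, if_neg (ENNReal.add_ne_top.2 ⟨hτ, hW⟩),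
        ENNReal.toReal_add hτ hW, Real.exp_add, jumpPosition]
      congr 2
      ring

/-- The probability of being in `A` at time `t` after `k` jumps. -/
theorem noise_between_jumps (hR : Measurable R)
    (hRloc : LocallyIntegrableOn (fun x => (R x : ℝ)) (Ioi 0)) {x : ℝ} (hx : 0 < x) (t : ℝ≥0)
    {A : Set ℝ} (hA : MeasurableSet A) (k : ℕ) :
    noise {ω | (jumpTime R x ω k ≤ t ∧ (t : ℝ≥0∞) < jumpTime R x ω (k + 1)) ∧
      x * Real.exp t * jumpProd ω k ∈ A} =
      ∫⁻ ω, atJump R (fun p =>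
        ({p : ℝ × ℝ | p.1 ≤ t}.indicator fun p => survivor R p.2 ((t : ℝ) - p.1).toNNReal) p *
          A.indicator 1 (p.2 * Real.exp (t - p.1))) k x ω ∂noise := by
  have hT (j : ℕ) : Measurable fun ω => jumpTime R x ω j :=
    Measurable.comp (g := fun p : ℝ × (ℕ → ℝ) => jumpTime R p.1 p.2 j)
      (f := fun ω => (x, ω)) (measurable_jumpTime hR j) measurable_prodMk_left
  set S := {ω | (jumpTime R x ω k ≤ t ∧ (t : ℝ≥0∞) < jumpTime R x ω (k + 1)) ∧
      x * Real.exp t * jumpProd ω k ∈ A} with hSdef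
  have hS : MeasurableSet S :=
    ((measurableSet_le (hT k) measurable_const).inter
      (measurableSet_lt measurable_const (hT (k + 1)))).inter
      (((measurable_jumpProd k).const_mul _) hA)
  rw [← lintegral_indicator_one hS,
    lintegral_noise_update (2 * k) (measurable_one.indicator hS)]
  refine lintegral_congr_ae ?_
  filter_upwards [ae_jumpProd_pos k] with ω hω
  have hpos : 0 < jumpPosition R x ω k := by
    unfold jumpPosition
    positivity
  have hmem (u : ℝ) : Function.update ω (2 * k) u ∈ S ↔
      (jumpTime R x ω k ≤ t ∧
        (t : ℝ≥0∞) < jumpTime R x ω k + waitingTime R (jumpPosition R x ω k) u) ∧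
      x * Real.exp t * jumpProd ω k ∈ A := by
    rw [hSdef, mem_ofPred_eq, jumpTime_succ, jumpTime_update x le_rfl, jumpProd_update le_rfl,
      jumpPosition_update x le_rfl, Function.update_self]
  by_cases hτ : jumpTime R x ω k ≤ t
  · have hτ' : jumpTime R x ω k ≠ ∞ := ne_top_of_le_ne_top ENNReal.coe_ne_top hτ
    have hτr : (jumpTime R x ω k).toReal ≤ t := by
      simpa using ENNReal.toReal_mono ENNReal.coe_ne_top hτ
    have hend : jumpPosition R x ω k * Real.exp (t - (jumpTime R x ω k).toReal) =
        x * Real.exp t * jumpProd ω k := by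
      rw [jumpPosition, mul_right_comm, mul_assoc x, ← Real.exp_add, add_sub_cancel]
    have hlt (u : ℝ) :
        (t : ℝ≥0∞) < jumpTime R x ω k + waitingTime R (jumpPosition R x ω k) u ↔
        ((((t : ℝ) - (jumpTime R x ω k).toReal).toNNReal : ℝ≥0) : ℝ≥0∞) <
          waitingTime R (jumpPosition R x ω k) u := by
      have h1 : (t : ℝ≥0∞) = jumpTime R x ω k +
          (((t : ℝ) - (jumpTime R x ω k).toReal).toNNReal : ℝ≥0) := by
        have h2 : (((((t : ℝ) - (jumpTime R x ω k).toReal).toNNReal : ℝ≥0)) : ℝ≥0∞) =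
          ENNReal.ofReal (t - (jumpTime R x ω k).toReal) := rfl
        rw [h2, ENNReal.ofReal_sub _ ENNReal.toReal_nonneg, ENNReal.ofReal_toReal hτ',
          ENNReal.ofReal_coe_nnreal, add_tsub_cancel_of_le hτ]
      conv_lhs => rw [h1]
      exact ENNReal.add_lt_add_iff_left hτ'
    rw [atJump, if_neg hτ', hend, indicator_of_mem (show ((jumpTime R x ω k).toReal, jumpPosition R x ω k) ∈
      {p : ℝ × ℝ | p.1 ≤ t} from hτr), ← uniform_lt_waitingTime hRloc hpos]
    by_cases hxA : x * Real.exp t * jumpProd ω k ∈ A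
    · have hWm : Measurable fun u => waitingTime R (jumpPosition R x ω k) u :=
        Measurable.comp (g := fun p : ℝ × ℝ => waitingTime R p.1 p.2)
          (f := fun u => (jumpPosition R x ω k, u))
          (measurable_waitingTime hR) measurable_prodMk_left
      rw [indicator_of_mem hxA, Pi.one_apply, mul_one, ← lintegral_indicator_one
        (measurableSet_lt measurable_const hWm)]
      refine lintegral_congr fun u => ?_
      refine indicator_eq_indicator ?_ rfl
      rw [hmem, mem_ofPred_eq, hlt]
      tauto
    · rw [indicator_of_notMem hxA, mul_zero]
      refine (lintegral_congr fun u => ?_).trans lintegral_zero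
      exact indicator_of_notMem (fun h => hxA ((hmem u).1 h).2) _
  · have hL (u : ℝ) : S.indicator (1 : (ℕ → ℝ) → ℝ≥0∞) (Function.update ω (2 * k) u) = 0 :=
      indicator_of_notMem (fun h => hτ ((hmem u).1 h).1.1) _
    simp only [hL, lintegral_zero, atJump]
    split_ifs with hτ'
    · rfl
    · rw [indicator_of_notMem, zero_mul]
      intro h
      apply hτ
      have h : (jumpTime R x ω k).toReal ≤ t := h
      rw [← ENNReal.ofReal_toReal hτ', ← ENNReal.ofReal_coe_nnreal]
      exact ENNReal.ofReal_le_ofReal h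

end Step

namespace IsBoundedWeakSolution

variable {R : ℝ → ℝ≥0} {M : ℝ≥0} {μ : ℝ≥0 → Measure ℝ}

/-- The flux dominates the law of the jumps of the process started from `μ 0`. -/
theorem sum_lintegral_atJump_le (h : IsBoundedWeakSolution R M μ) (hR : Measurable R)
    (hRloc : LocallyIntegrableOn (fun x => (R x : ℝ)) (Ioi 0)) (n : ℕ) {Φ : ℝ × ℝ → ℝ≥0∞}
    (hΦ : Measurable Φ) :
    ∑ k ∈ Finset.range n, ∫⁻ x, ∫⁻ ω, atJump R Φ (k + 1) x ω ∂noise ∂(μ 0) ≤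
      ∫⁻ p, Φ p ∂h.flux := by
  induction n generalizing Φ with
  | zero => simp
  | succ n ih =>
    have := h.isProbabilityMeasure 0
    have hsucc (k : ℕ) : ∫⁻ x, ∫⁻ ω, atJump R Φ (k + 1) x ω ∂noise ∂(μ 0) =
        ∫⁻ x, ∫⁻ ω, atJump R (jumpStep R Φ) k x ω ∂noise ∂(μ 0) := by
      refine lintegral_congr_ae ?_
      filter_upwards [h.ae_pos 0] with x hx
      exact lintegral_atJump_succ hR hRloc hx hΦ k
    set g : ℝ → ℝ → ℝ≥0∞ := fun t x => ENNReal.ofReal x * R x *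
      ∫⁻ v, Φ (t, x * √v) ∂uniform with hg
    have hgm : Measurable fun q : ℝ × ℝ => g q.1 q.2 := by
      have h2 : Measurable fun q : (ℝ × ℝ) × ℝ => Φ (q.1.1, q.1.2 * √q.2) :=
        hΦ.comp (by fun_prop)
      exact Measurable.mul (by fun_prop) h2.lintegral_prod_right'
    have hm1 : Measurable fun q : ℝ × ℝ =>
        survivor R q.2 q.1.toNNReal * g q.1 (q.2 * Real.exp q.1) :=
      ((measurable_survivor_uncurry hR).comp measurable_swap).mul
        (hgm.comp (by fun_prop : Measurable fun q : ℝ × ℝ => (q.1, q.2 * Real.exp q.1)))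
    have hm2 : Measurable fun q : ℝ × (ℝ × ℝ) =>
        ({p : ℝ × ℝ | p.1 ≤ q.1}.indicator fun p => survivor R p.2 (q.1 - p.1).toNNReal) q.2 *
          g q.1 (q.2.2 * Real.exp (q.1 - q.2.1)) := by
      have h1 : Measurable ({q : ℝ × (ℝ × ℝ) | q.2.1 ≤ q.1}.indicator
          fun q => survivor R q.2.2 (q.1 - q.2.1).toNNReal) :=
        ((measurable_survivor_uncurry hR).comp (by fun_prop :
          Measurable fun q : ℝ × (ℝ × ℝ) => (q.2.2, q.1 - q.2.1))).indicator
          (measurableSet_le (by fun_prop) (by fun_prop))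
      exact h1.mul (hgm.comp (by fun_prop :
        Measurable fun q : ℝ × (ℝ × ℝ) => (q.1, q.2.2 * Real.exp (q.1 - q.2.1))))
    have hfirst : ∫⁻ t in Ioi 0, ∫⁻ x, survivor R x t.toNNReal * g t (x * Real.exp t) ∂(μ 0) =
        ∫⁻ x, ∫⁻ ω, atJump R Φ (0 + 1) x ω ∂noise ∂(μ 0) := by
      rw [hsucc, lintegral_lintegral_swap hm1.aemeasurable]
      refine lintegral_congr fun x => ?_
      have h1 (ω : ℕ → ℝ) : atJump R (jumpStep R Φ) 0 x ω = jumpStep R Φ (0, x) := by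
        simp [atJump, jumpPosition, jumpTime, jumpProd]
      simp only [h1, lintegral_const, measure_univ, mul_one, jumpStep, zero_add]
      refine lintegral_congr fun r => ?_
      simp only [hg, waitingDensity]
      ring
    have hlater : ∫⁻ t in Ioi 0, ∫⁻ p, ({p : ℝ × ℝ | p.1 ≤ t}.indicator
          fun p => survivor R p.2 (t - p.1).toNNReal) p *
            g t (p.2 * Real.exp (t - p.1)) ∂h.flux =
        ∫⁻ p, jumpStep R Φ p ∂h.flux := by
      rw [lintegral_lintegral_swap hm2.aemeasurable]
      refine lintegral_congr_ae ?_
      filter_upwards [h.ae_flux_time_pos hR] with p hp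
      rw [← lintegral_indicator measurableSet_Ioi, ← lintegral_add_right_eq_self _ p.1,
        jumpStep, restrict_Ioi_eq_restrict_Ici, ← lintegral_indicator measurableSet_Ici]
      refine lintegral_congr fun r => ?_
      by_cases hr : 0 ≤ r
      · rw [indicator_of_mem (show r + p.1 ∈ Ioi 0 by rw [mem_Ioi]; linarith),
          indicator_of_mem (show p ∈ {q : ℝ × ℝ | q.1 ≤ r + p.1} by
            rw [mem_ofPred_eq]; linarith),
          indicator_of_mem (show r ∈ Ici 0 from hr)]
        simp only [hg, waitingDensity, add_comm p.1 r, add_sub_cancel_right]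
        ring
      · rw [indicator_of_notMem (show r ∉ Ici 0 from hr)]
        by_cases hr2 : r + p.1 ∈ Ioi 0
        · rw [indicator_of_mem hr2, indicator_of_notMem (show p ∉ {q : ℝ × ℝ | q.1 ≤ r + p.1} by
            rw [mem_ofPred_eq]; linarith), zero_mul]
        · rw [indicator_of_notMem hr2]
    have hflux : ∫⁻ p, Φ p ∂h.flux =
        (∫⁻ x, ∫⁻ ω, atJump R Φ (0 + 1) x ω ∂noise ∂(μ 0)) +
          ∫⁻ p, jumpStep R Φ p ∂h.flux := by
      rw [h.lintegral_flux hR hΦ, ← hfirst, ← hlater,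
        ← lintegral_add_left hm1.lintegral_prod_right']
      refine setLIntegral_congr_fun measurableSet_Ioi fun t ht => ?_
      simp only
      rw [h.eq_renewal hR hRloc (le_of_lt ht)]
      exact h.lintegral_renewal hR t (hgm.comp measurable_prodMk_left)
    rw [Finset.sum_range_succ', hflux, add_comm]
    refine add_le_add le_rfl (le_trans (le_of_eq ?_) (ih (measurable_jumpStep hR hΦ)))
    exact Finset.sum_congr rfl fun k _ => hsucc (k + 1)

theorem flux_time_le (h : IsBoundedWeakSolution R M μ) (hR : Measurable R) (t : ℝ≥0) :
    h.flux {p | p.1 ≤ t} ≤ M * t := by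
  have hs : MeasurableSet {p : ℝ × ℝ | p.1 ≤ t} :=
    measurableSet_le measurable_fst measurable_const
  rw [← lintegral_indicator_one hs, h.lintegral_flux hR (measurable_one.indicator hs)]
  calc _ ≤ ∫⁻ s in Ioi (0 : ℝ), (Iic (t : ℝ)).indicator (fun _ => (M : ℝ≥0∞)) s := by
        refine lintegral_mono fun s => ?_
        by_cases hst : s ≤ t
        · rw [indicator_of_mem (show s ∈ Iic (t : ℝ) from hst)]
          have h0 (y : ℝ) : ({p : ℝ × ℝ | p.1 ≤ t}).indicator (1 : ℝ × ℝ → ℝ≥0∞) (s, y) = 1 :=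
            indicator_of_mem (show (s, y) ∈ {p : ℝ × ℝ | p.1 ≤ t} from hst) _
          simp only [h0, lintegral_const, measure_univ, mul_one]
          exact h.lintegral_rate_le _
        · have h0 (y : ℝ) : ({p : ℝ × ℝ | p.1 ≤ t}).indicator (1 : ℝ × ℝ → ℝ≥0∞) (s, y) = 0 :=
            indicator_of_notMem (show (s, y) ∉ {p : ℝ × ℝ | p.1 ≤ t} from hst) _
          simp only [h0, lintegral_zero, mul_zero]
          exact zero_le
    _ = M * t := by
        rw [lintegral_indicator_const measurableSet_Iic,
          Measure.restrict_apply measurableSet_Iic, inter_comm, Ioi_inter_Iic, Real.volume_Ioc,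
          sub_zero, ENNReal.ofReal_coe_nnreal]

theorem measurableSet_jumpTime_le (hR : Measurable R) (k : ℕ) (t : ℝ≥0) :
    MeasurableSet {p : ℝ × (ℕ → ℝ) | jumpTime R p.1 p.2 k ≤ t} :=
  measurableSet_le (measurable_jumpTime hR k) measurable_const

/-- There are almost surely finitely many jumps before time `t`. -/
theorem ae_exists_lt_jumpTime (h : IsBoundedWeakSolution R M μ) (hR : Measurable R)
    (hRloc : LocallyIntegrableOn (fun x => (R x : ℝ)) (Ioi 0)) (t : ℝ≥0) :
    ∀ᵐ p ∂((μ 0).prod noise), ∃ k, (t : ℝ≥0∞) < jumpTime R p.1 p.2 k := by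
  have := h.isProbabilityMeasure 0
  have hs : MeasurableSet {p : ℝ × ℝ | p.1 ≤ t} :=
    measurableSet_le measurable_fst measurable_const
  have hprob (k : ℕ) : (μ 0).prod noise {p | jumpTime R p.1 p.2 k ≤ t} =
      ∫⁻ x, ∫⁻ ω, atJump R ({p : ℝ × ℝ | p.1 ≤ t}.indicator 1) k x ω ∂noise ∂(μ 0) := by
    rw [Measure.prod_apply (measurableSet_jumpTime_le hR k t)]
    refine lintegral_congr fun x => ?_
    rw [← lintegral_indicator_one
      (measurable_prodMk_left (measurableSet_jumpTime_le hR k t))]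
    refine lintegral_congr fun ω => ?_
    rw [atJump]
    split_ifs with hτ
    · exact indicator_of_notMem (by simp [hτ]) _
    · refine indicator_eq_indicator ?_ rfl
      simp only [mem_preimage, mem_ofPred_eq]
      exact ENNReal.le_coe_iff.trans ⟨fun ⟨q, hq, hqt⟩ => by rw [hq]; exact_mod_cast hqt,
        fun hle => ⟨(jumpTime R x ω k).toNNReal, (ENNReal.coe_toNNReal hτ).symm,
          NNReal.coe_le_coe.1 hle⟩⟩
  have hsum : ∑' k, (μ 0).prod noise {p | jumpTime R p.1 p.2 (k + 1) ≤ t} ≠ ∞ := by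
    refine ne_top_of_le_ne_top (ENNReal.mul_ne_top ENNReal.coe_ne_top ENNReal.coe_ne_top :
      (M : ℝ≥0∞) * t ≠ ∞) ?_
    rw [ENNReal.tsum_eq_iSup_nat]
    refine iSup_le fun n => ?_
    simp only [hprob]
    refine (h.sum_lintegral_atJump_le hR hRloc n (measurable_one.indicator hs)).trans ?_
    rw [lintegral_indicator_one hs]
    exact h.flux_time_le hR t
  filter_upwards [ae_eventually_notMem hsum] with p hp
  obtain ⟨k, hk⟩ := hp.exists
  exact ⟨k + 1, not_le.1 hk⟩

/-- A weak solution dominates, hence equals, the flow of its initial value. -/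
theorem eq_bind_transition (h : IsBoundedWeakSolution R M μ) (hR : Measurable R)
    (hRloc : LocallyIntegrableOn (fun x => (R x : ℝ)) (Ioi 0)) (t : ℝ≥0) :
    μ t = (μ 0).bind (transition hR t) := by
  have := h.isProbabilityMeasure 0
  have := h.isProbabilityMeasure t
  have hpath (x : ℝ) : Measurable fun ω => path R x ω t :=
    Measurable.comp (g := fun p : ℝ × (ℕ → ℝ) => path R p.1 p.2 t)
      (f := fun ω => (x, ω)) (measurable_path hR t) measurable_prodMk_left
  have hMarkov : IsMarkovKernel (transition hR t) :=
    ⟨fun x => Measure.isProbabilityMeasure_map (μ := noise) (hpath x).aemeasurable⟩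
  have hE (k : ℕ) : MeasurableSet {p : ℝ × (ℕ → ℝ) |
      jumpTime R p.1 p.2 k ≤ t ∧ (t : ℝ≥0∞) < jumpTime R p.1 p.2 (k + 1)} :=
    (measurableSet_jumpTime_le hR k t).inter
      (measurableSet_lt measurable_const (measurable_jumpTime hR (k + 1)))
  refine (Measure.eq_of_le_of_isProbabilityMeasure (Measure.le_intro fun A hA _ => ?_)).symm
  have hbind : (μ 0).bind (transition hR t) A =
      (μ 0).prod noise {p | path R p.1 p.2 t ∈ A} := by
    rw [Measure.bind_apply hA (transition hR t).aemeasurable,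
      Measure.prod_apply (show MeasurableSet {p : ℝ × (ℕ → ℝ) | path R p.1 p.2 t ∈ A} from
        measurable_path hR t hA)]
    refine lintegral_congr fun x => ?_
    exact Measure.map_apply (hpath x) hA
  set Θ : ℝ × ℝ → ℝ≥0∞ := fun p =>
    ({p : ℝ × ℝ | p.1 ≤ t}.indicator fun p => survivor R p.2 ((t : ℝ) - p.1).toNNReal) p *
      A.indicator 1 (p.2 * Real.exp (t - p.1)) with hΘ
  have hΘm : Measurable Θ :=
    (measurable_survivor_indicator hR t).mul ((measurable_one.indicator hA).comp (by fun_prop))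
  have hAm (k : ℕ) : MeasurableSet {p : ℝ × (ℕ → ℝ) |
      (jumpTime R p.1 p.2 k ≤ t ∧ (t : ℝ≥0∞) < jumpTime R p.1 p.2 (k + 1)) ∧
        p.1 * Real.exp t * jumpProd p.2 k ∈ A} :=
    (hE k).inter (((measurable_fst.mul_const _).mul
      ((measurable_jumpProd k).comp measurable_snd)) hA)
  have hpiece (k : ℕ) : (μ 0).prod noise {p : ℝ × (ℕ → ℝ) |
      (jumpTime R p.1 p.2 k ≤ t ∧ (t : ℝ≥0∞) < jumpTime R p.1 p.2 (k + 1)) ∧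
        p.1 * Real.exp t * jumpProd p.2 k ∈ A} =
      ∫⁻ x, ∫⁻ ω, atJump R Θ k x ω ∂noise ∂(μ 0) := by
    rw [Measure.prod_apply (hAm k)]
    refine lintegral_congr_ae ?_
    filter_upwards [h.ae_pos 0] with x hx
    exact noise_between_jumps hR hRloc hx t hA k
  have hzero : ∫⁻ x, ∫⁻ ω, atJump R Θ 0 x ω ∂noise ∂(μ 0) =
      ∫⁻ x, survivor R x t * A.indicator 1 (x * Real.exp t) ∂(μ 0) := by
    refine lintegral_congr fun x => ?_
    have h1 (ω : ℕ → ℝ) : atJump R Θ 0 x ω = survivor R x t * A.indicator 1 (x * Real.exp t) := by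
      simp [atJump, jumpPosition, jumpTime, jumpProd, hΘ]
    simp only [h1, lintegral_const, measure_univ, mul_one]
  have hren : μ t A = (∫⁻ x, ∫⁻ ω, atJump R Θ 0 x ω ∂noise ∂(μ 0)) + ∫⁻ p, Θ p ∂h.flux := by
    have h1 := h.lintegral_renewal hR t (measurable_one.indicator hA)
    rw [← h.eq_renewal hR hRloc t.coe_nonneg, Real.toNNReal_coe, lintegral_indicator_one hA] at h1
    rw [h1, hzero]
  calc (μ 0).bind (transition hR t) A
      = (μ 0).prod noise {p | path R p.1 p.2 t ∈ A} := hbind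
    _ ≤ (μ 0).prod noise (⋃ k, {p : ℝ × (ℕ → ℝ) |
          (jumpTime R p.1 p.2 k ≤ t ∧ (t : ℝ≥0∞) < jumpTime R p.1 p.2 (k + 1)) ∧
            p.1 * Real.exp t * jumpProd p.2 k ∈ A}) := by
        refine measure_mono_ae ?_
        filter_upwards [h.ae_exists_lt_jumpTime hR hRloc t] with p hp hpA
        classical
        have hk := Nat.find_spec hp
        have hk0 : Nat.find hp ≠ 0 := fun h0 => by
          rw [h0] at hk
          exact absurd hk (by simp [jumpTime])
        obtain ⟨j, hj⟩ := Nat.exists_eq_succ_of_ne_zero hk0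
        have hex : ∃ k, jumpTime R p.1 p.2 k ≤ t ∧ (t : ℝ≥0∞) < jumpTime R p.1 p.2 (k + 1) :=
          ⟨j, not_lt.1 (Nat.find_min hp (by omega)), by rw [hj] at hk; exact hk⟩
        have hpA : path R p.1 p.2 t ∈ A := hpA
        rw [path, dif_pos hex] at hpA
        exact mem_iUnion.2 ⟨_, Nat.find_spec hex, hpA⟩
    _ ≤ ∑' k, ∫⁻ x, ∫⁻ ω, atJump R Θ k x ω ∂noise ∂(μ 0) := by
        refine (measure_iUnion_le _).trans (le_of_eq ?_)
        simp only [hpiece]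
    _ = (∫⁻ x, ∫⁻ ω, atJump R Θ 0 x ω ∂noise ∂(μ 0)) +
          ∑' k, ∫⁻ x, ∫⁻ ω, atJump R Θ (k + 1) x ω ∂noise ∂(μ 0) :=
        tsum_eq_zero_add' ENNReal.summable
    _ ≤ (∫⁻ x, ∫⁻ ω, atJump R Θ 0 x ω ∂noise ∂(μ 0)) + ∫⁻ p, Θ p ∂h.flux := by
        refine add_le_add le_rfl ?_
        rw [ENNReal.tsum_eq_iSup_nat]
        exact iSup_le fun n => h.sum_lintegral_atJump_le hR hRloc n hΘm
    _ = μ t A := hren.symm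

end IsBoundedWeakSolution

/-! ### Bounded densities with respect to a stationary solution -/

theorem le_smul_of_essSup_rnDeriv_le {μ π : Measure ℝ} [IsFiniteMeasure μ] [IsFiniteMeasure π]
    (hac : μ ≪ π) {C : ℝ≥0∞} (hC : essSup (μ.rnDeriv π) π ≤ C) : μ ≤ C • π := by
  rw [← Measure.withDensity_rnDeriv_eq μ π hac, ← withDensity_const]
  exact withDensity_mono (ENNReal.ae_le_essSup _ |>.mono fun x hx => hx.trans hC)

theorem IsStationary.isBoundedWeakSolution {R : ℝ → ℝ≥0} (hR : Measurable R) {π : Measure ℝ}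
    (hπ : IsStationary R π) {μ : ℝ≥0 → Measure ℝ} (hμmeas : Measurable μ)
    (hμprob : ∀ t, IsProbabilityMeasure (μ t)) {C : ℝ≥0} (hC : ∀ t, μ t ≤ (C : ℝ≥0∞) • π)
    (hμ : ∀ f : ℝ → ℝ, IsTestFunction f → ∀ t : ℝ≥0,
      (∫ x, f x ∂(μ t)) - (∫ x, f x ∂(μ 0)) =
        ∫ s in (0 : ℝ)..t, ∫ x, generator R f x ∂(μ s.toNNReal)) :
    IsBoundedWeakSolution R (C * 2) μ where
  measurable := hμmeas
  isProbabilityMeasure := hμprob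
  measure_Iic_zero t := by
    refine le_antisymm ((hC t _).trans ?_) zero_le
    simp [hπ.measure_Iic_zero]
  lintegral_rate_le t := by
    refine (lintegral_mono' (hC t) le_rfl).trans ?_
    rw [lintegral_smul_measure, hπ.lintegral_rate hR]
    simp
  restrict_Ioc_le a b ha := by
    have hfin := hπ.tailRate_lt_top ha
    refine ⟨C * (b.toNNReal * (tailRate R π a).toNNReal), fun t => ?_⟩
    refine (Measure.restrict_mono le_rfl (hC t)).trans ?_
    rw [Measure.restrict_smul, ENNReal.coe_mul, ENNReal.coe_mul, ENNReal.coe_toNNReal hfin.ne,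
      mul_smul]
    intro s
    simp only [Measure.smul_apply, smul_eq_mul]
    gcongr
    exact hπ.restrict_Ioc_le ha s
  equation := hμ

end CellProcess

theorem proposition3p7
    (R : ℝ → ℝ≥0) (hR : Measurable R)
    (hRloc : LocallyIntegrableOn (fun x => (R x : ℝ)) (Ioi 0))
    (π : Measure ℝ) (hπ : CellProcess.IsStationary R π)
    (μ : ℝ≥0 → Measure ℝ) (hμmeas : Measurable μ)
    (hμprob : ∀ t, IsProbabilityMeasure (μ t))
    (hμac : ∀ t, μ t ≪ π)
    (hμbdd : ⨆ t, essSup ((μ t).rnDeriv π) π < ∞)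
    (hμ : ∀ f : ℝ → ℝ, CellProcess.IsTestFunction f → ∀ t : ℝ≥0,
      (∫ x, f x ∂(μ t)) - (∫ x, f x ∂(μ 0)) =
        ∫ s in (0 : ℝ)..t, ∫ x, CellProcess.generator R f x ∂(μ s.toNNReal)) :
    ∀ t : ℝ≥0, μ t = (μ 0).bind (CellProcess.transition hR t) := by
  have := hπ.isProbabilityMeasure
  have hle (t : ℝ≥0) :
      μ t ≤ (((⨆ t, essSup ((μ t).rnDeriv π) π).toNNReal : ℝ≥0) : ℝ≥0∞) • π := by
    have := hμprob t
    refine CellProcess.le_smul_of_essSup_rnDeriv_le (hμac t) ?_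
    rw [ENNReal.coe_toNNReal hμbdd.ne]
    exact le_iSup (fun t => essSup ((μ t).rnDeriv π) π) t
  exact (hπ.isBoundedWeakSolution hR hμmeas hμprob hle hμ).eq_bind_transition hR hRloc
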